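/- Let $S$ be a commutative ring with an ideal $\mathfrak m$, in one of the following situations: * (L) $S$ is a regular local ring with maximal ideal $\mathfrak m$; * (G) $S=\Bbbk[x_1,\dots,x_n]$ is a polynomial ring over a field with its standard $\mathbb Z$-grading, $\mathfrak m=\langle x_1,\dots,x_n\rangle$; * (M) $S=\Bbbk[x_1,\dots,x_n]$ is a polynomial ring over a field with its fine $\mathbb Z^n$-grading, $\mathfrak m=\langle x_1,\dots,x_n\rangle$. For an ideal $J\subseteq S$ (homogeneous for the given grading in the cases (G), (M)), a minimal free resolution of $S/J$ is a complex $(\mathbb F,\partial)$ of finitely generated free modules $\cdots\to\mathbb F_2\to\mathbb F_1\to\mathbb F_0\to 0$, exact in positive homological degrees, with $\mathbb F_0=S$, $\mathbb F_0/\partial\mathbb F_1=S/J$ and $\partial\mathbb F\subseteq\mathfrak m\mathbb F$ (and $\mathbb F=0$ if $J=S$); in the cases (G), (M) it is moreover graded, with $\partial$ homogeneous of degree $0$ and $1\in\mathbb F_0$ in degree $0$. It *admits a DGA structure* if there is an $S$-bilinear associative multiplication $*$ on $\mathbb F=\bigoplus_i\mathbb F_i$ with unit $1\in\mathbb F_0$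 (so that $*$ extends the multiplication of $\mathbb F_0=S$) such that $\mathbb F_i*\mathbb F_j\subseteq\mathbb F_{i+j}$, $a*b=(-1)^{ij}\,b*a$ and $\partial(a*b)=\partial a*b+(-1)^{i}a*\partial b$ for all $a\in\mathbb F_i$, $b\in\mathbb F_j$, and such that, in the cases (G), (M), $*$ respects the grading. **Theorem 2.1.** 1. In case (L), for every ideal $I\subseteq S$ there is a nonzero $s\in S$ such that the minimal free resolution of $S/(sI)$ exists and admits a DGA structure. 2. In case (G), for every homogeneous ideal $I\subseteq S$ there is a nonzero homogeneous $s\in S$ such that the minimal graded free resolution of $S/(sI)$ exists and admits a DGA structure. 3. In case (M), if $I$ is generated by a finite set of monomials and $s$ is the least common multiple of these monomials, then the minimal $\mathbb Z^n$-graded free resolution of $S/(sI)$ exists and admits a DGA structure. In each case, if $I\neq S$, the resolutions of $S/I$ and $S/(sI)$ differ only in the last map: replacing $\partial:\mathbb F_1\to\mathbb F_0$ by $s\,\partial:\mathbb F_1\to\mathbb F_0$ in any minimal free resolution $\mathbb F$ of $S/I$ (and, in the cases (G), (M), raising the degrees in $\mathbb F_i$, $i\ge1$, by $\deg s$) gives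 a minimal free resolution of $S/(sI)$. -/

import Mathlib

universe u

/-!
Homologically graded complexes are written internally: the complex
`⋯ → F₂ → F₁ → F₀ → 0` is one module `F = ⨁ i, 𝓕 i` with an endomorphism `d` of degree `-1`.
-/

/-- `(F, d)`, with homological grading `𝓕`, is a minimal free resolution of `S ⧸ J`, where
minimality is taken with respect to the ideal `𝔪` (the maximal ideal of a local ring, or the
irrelevant ideal of a polynomial ring). The element `one : F` is the generator `1` of `F₀ = S`;
the augmentation `F₀ → S ⧸ J` sends `r • one` to the class of `r`.
(If `J = ⊤`, minimality forces `F = 0`, the minimal free resolution of the zero module.) -/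
structure IsMinimalFreeResolution {S F : Type*} [CommRing S] [AddCommGroup F] [Module S F]
    (𝔪 J : Ideal S) (𝓕 : ℕ → Submodule S F) (d : F →ₗ[S] F) (one : F) : Prop where
  isInternal : DirectSum.IsInternal 𝓕
  free : ∀ i, Module.Free S (𝓕 i)
  finite : ∀ i, Module.Finite S (𝓕 i)
  d_zero : ∀ x ∈ 𝓕 0, d x = 0
  d_succ : ∀ i, ∀ x ∈ 𝓕 (i + 1), d x ∈ 𝓕 i
  /-- exactness at `F_{i+1}`: the cycles are the boundaries -/
  exact : ∀ i, LinearMap.ker d ⊓ 𝓕 (i + 1) = (𝓕 (i + 2)).map d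
  /-- `F₀ = S • one` -/
  span_one : 𝓕 0 = Submodule.span S {one}
  /-- `F₀ ⧸ d F₁ = S ⧸ J` -/
  smul_one_mem : ∀ r : S, r • one ∈ (𝓕 1).map d ↔ r ∈ J
  minimal : ∀ x, d x ∈ 𝔪 • (⊤ : Submodule S F)

/-- `𝓖` is an internal grading of `F` by the group `A` which makes the complex of free modules
`(F, d)` a complex of graded free modules over the polynomial ring graded by `deg (X i) = w i`,
with `d` homogeneous of degree `0` and `one` in degree `0`. -/
structure IsInternallyGraded {k F A : Type*} {n : ℕ} [Field k] [AddCommGroup F]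
    [Module (MvPolynomial (Fin n) k) F] [AddCommGroup A] [DecidableEq A] (w : Fin n → A)
    (𝓖 : A → AddSubgroup F) (𝓕 : ℕ → Submodule (MvPolynomial (Fin n) k) F)
    (d : F →ₗ[MvPolynomial (Fin n) k] F) (one : F) : Prop where
  isInternal : DirectSum.IsInternal 𝓖
  smul_mem : ∀ (a b : A) (p : MvPolynomial (Fin n) k) (x : F),
    MvPolynomial.IsWeightedHomogeneous w p a → x ∈ 𝓖 b → p • x ∈ 𝓖 (a + b)
  /-- each `F_i` has a finite basis of homogeneous elements -/
  basis : ∀ i, ∃ (m : ℕ) (b : Module.Basis (Fin m) (MvPolynomial (Fin n) k) (𝓕 i))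
    (deg : Fin m → A), ∀ j, (b j : F) ∈ 𝓖 (deg j)
  d_mem : ∀ a, ∀ x ∈ 𝓖 a, d x ∈ 𝓖 a
  one_mem : one ∈ 𝓖 0

/-- `mul` is a (graded-commutative, associative) DGA structure on the complex `(F, d)` whose
restriction to `F₀ = S • one` is the multiplication of `S`. -/
structure IsDGA {S F : Type*} [CommRing S] [AddCommGroup F] [Module S F]
    (𝓕 : ℕ → Submodule S F) (d : F →ₗ[S] F) (one : F) (mul : F →ₗ[S] F →ₗ[S] F) : Prop where
  one_mul : ∀ a, mul one a = a
  mul_one : ∀ a, mul a one = a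
  leibniz : ∀ i, ∀ a ∈ 𝓕 i, ∀ b, d (mul a b) = mul (d a) b + (-1 : S) ^ i • mul a (d b)
  mul_mem : ∀ i j, ∀ a ∈ 𝓕 i, ∀ b ∈ 𝓕 j, mul a b ∈ 𝓕 (i + j)
  comm : ∀ i j, ∀ a ∈ 𝓕 i, ∀ b ∈ 𝓕 j, mul a b = (-1 : S) ^ (i * j) • mul b a
  assoc : ∀ a b c, mul (mul a b) c = mul a (mul b c)

/-- `d'` is obtained from the differential `d` by replacing the last map `d : F₁ → F₀` by
`s • d : F₁ → F₀`. -/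
def IsLastMapScaled {S F : Type*} [CommRing S] [AddCommGroup F] [Module S F]
    (𝓕 : ℕ → Submodule S F) (s : S) (d d' : F →ₗ[S] F) : Prop :=
  (∀ x ∈ 𝓕 1, d' x = s • d x) ∧ ∀ i, i ≠ 1 → ∀ x ∈ 𝓕 i, d' x = d x

/-- `𝓖'` is obtained from the grading `𝓖` by keeping the degrees on `F₀` and raising the
degrees on `F_i`, `i ≥ 1`, by `D`. -/
def IsGradingShifted {S F A : Type*} [CommRing S] [AddCommGroup F] [Module S F]
    [AddCommGroup A] (𝓕 : ℕ → Submodule S F) (D : A) (𝓖 𝓖' : A → AddSubgroup F) : Prop :=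
  (∀ a, ∀ x ∈ 𝓕 0, (x ∈ 𝓖' a ↔ x ∈ 𝓖 a)) ∧
    ∀ i a, ∀ x ∈ 𝓕 (i + 1), (x ∈ 𝓖' (a + D) ↔ x ∈ 𝓖 a)

/-- "The minimal free resolution of `S ⧸ J` admits a DGA structure", `S` local: a minimal free
resolution exists, and every one of them carries a DGA structure. -/
def LocalMinimalResolutionAdmitsDGA {S : Type u} [CommRing S] [IsLocalRing S]
    (J : Ideal S) : Prop :=
  (∃ (F : Type u) (_ : AddCommGroup F) (_ : Module S F) (𝓕 : ℕ → Submodule S F)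
    (d : F →ₗ[S] F) (one : F),
    IsMinimalFreeResolution (IsLocalRing.maximalIdeal S) J 𝓕 d one) ∧
  ∀ (F : Type u) [AddCommGroup F] [Module S F] (𝓕 : ℕ → Submodule S F)
    (d : F →ₗ[S] F) (one : F),
    IsMinimalFreeResolution (IsLocalRing.maximalIdeal S) J 𝓕 d one →
      ∃ mul : F →ₗ[S] F →ₗ[S] F, IsDGA 𝓕 d one mul

/-- `S` local: from any minimal free resolution of `S ⧸ I` one obtains a minimal free resolution
of `S ⧸ sI` by multiplying the last map by `s`. -/
def LocalResolutionsDifferInLastMap {S : Type u} [CommRing S] [IsLocalRing S]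
    (I : Ideal S) (s : S) : Prop :=
  ∀ (F : Type u) [AddCommGroup F] [Module S F] (𝓕 : ℕ → Submodule S F)
    (d : F →ₗ[S] F) (one : F),
    IsMinimalFreeResolution (IsLocalRing.maximalIdeal S) I 𝓕 d one →
      ∃ d' : F →ₗ[S] F, IsLastMapScaled 𝓕 s d d' ∧
        IsMinimalFreeResolution (IsLocalRing.maximalIdeal S) (Ideal.span {s} * I) 𝓕 d' one

/-- "The graded minimal free resolution of `S ⧸ J` admits a DGA structure", `S` a polynomial ring
graded by `deg (X i) = w i`: a graded minimal free resolution exists, and every one of them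
carries a DGA structure whose multiplication respects the grading. -/
def GradedMinimalResolutionAdmitsDGA {k : Type u} [Field k] {n : ℕ} {A : Type}
    [AddCommGroup A] [DecidableEq A] (w : Fin n → A)
    (J : Ideal (MvPolynomial (Fin n) k)) : Prop :=
  (∃ (F : Type u) (_ : AddCommGroup F) (_ : Module (MvPolynomial (Fin n) k) F)
    (𝓕 : ℕ → Submodule (MvPolynomial (Fin n) k) F) (d : F →ₗ[MvPolynomial (Fin n) k] F)
    (one : F) (𝓖 : A → AddSubgroup F),
    IsMinimalFreeResolution (MvPolynomial.idealOfVars (Fin n) k) J 𝓕 d one ∧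
      IsInternallyGraded w 𝓖 𝓕 d one) ∧
  ∀ (F : Type u) [AddCommGroup F] [Module (MvPolynomial (Fin n) k) F]
    (𝓕 : ℕ → Submodule (MvPolynomial (Fin n) k) F) (d : F →ₗ[MvPolynomial (Fin n) k] F)
    (one : F) (𝓖 : A → AddSubgroup F),
    IsMinimalFreeResolution (MvPolynomial.idealOfVars (Fin n) k) J 𝓕 d one →
      IsInternallyGraded w 𝓖 𝓕 d one →
        ∃ mul : F →ₗ[MvPolynomial (Fin n) k] F →ₗ[MvPolynomial (Fin n) k] F,
          IsDGA 𝓕 d one mul ∧ ∀ a b, ∀ x ∈ 𝓖 a, ∀ y ∈ 𝓖 b, mul x y ∈ 𝓖 (a + b)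

/-- `S` a graded polynomial ring, `s` homogeneous of degree `D`: from any graded minimal free
resolution of `S ⧸ I` one obtains a graded minimal free resolution of `S ⧸ sI` by multiplying the
last map by `s` (and raising the degrees in positive homological degrees by `D`). -/
def GradedResolutionsDifferInLastMap {k : Type u} [Field k] {n : ℕ} {A : Type}
    [AddCommGroup A] [DecidableEq A] (w : Fin n → A)
    (I : Ideal (MvPolynomial (Fin n) k)) (s : MvPolynomial (Fin n) k) (D : A) : Prop :=
  ∀ (F : Type u) [AddCommGroup F] [Module (MvPolynomial (Fin n) k) F]
    (𝓕 : ℕ → Submodule (MvPolynomial (Fin n) k) F) (d : F →ₗ[MvPolynomial (Fin n) k] F)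
    (one : F) (𝓖 : A → AddSubgroup F),
    IsMinimalFreeResolution (MvPolynomial.idealOfVars (Fin n) k) I 𝓕 d one →
      IsInternallyGraded w 𝓖 𝓕 d one →
        ∃ (d' : F →ₗ[MvPolynomial (Fin n) k] F) (𝓖' : A → AddSubgroup F),
          IsLastMapScaled 𝓕 s d d' ∧ IsGradingShifted 𝓕 D 𝓖 𝓖' ∧
            IsMinimalFreeResolution (MvPolynomial.idealOfVars (Fin n) k)
              (Ideal.span {s} * I) 𝓕 d' one ∧
            IsInternallyGraded w 𝓖' 𝓕 d' one

/-- The weights of the standard `ℤ`-grading of `k[x₁, …, xₙ]`. -/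
def standardWeight (n : ℕ) : Fin n → ℤ := fun _ => 1

/-- The weights of the fine `ℤⁿ`-grading of `k[x₁, …, xₙ]`. -/
def fineWeight (n : ℕ) : Fin n → (Fin n → ℤ) := fun i => Pi.single i 1

/-- The ideal generated by the monomials with exponents in `G`. -/
noncomputable def monomialIdeal (k : Type*) [Field k] {n : ℕ} (G : Finset (Fin n →₀ ℕ)) :
    Ideal (MvPolynomial (Fin n) k) :=
  Ideal.span ((fun g => MvPolynomial.monomial g (1 : k)) '' (G : Set (Fin n →₀ ℕ)))

/-- The exponent of the least common multiple of the monomials with exponents in `G`: the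
componentwise maximum. -/
noncomputable def lcmExponent {n : ℕ} (G : Finset (Fin n →₀ ℕ)) : Fin n →₀ ℕ := G.sup id

/-! Suppose `S` is a domain, `s ≠ 0` and `sI ≠ S`. Since `I ≅ sI`, the part `P = F_{≥1}` of a
minimal resolution of `S/(sI)` resolves `I` through a map `lam : F₁ → I` with `∂ = s·lam` on `F₁`;
extend `lam` by zero. Let `ρ` be an endomorphism of `P` of degree `1` with `ρ² = 0`, `∂ρ + ρ∂ = s`
in degrees `≥ 2` and `∂ρ(x) = s x - lam(x) u` on `F₁` for a fixed `u`. Then `a * c = lam(a) ρ(c) +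
(-1)^{|a|} lam(c) ρ(a)` on `P`, with `1` as unit, is a DGA structure. The Leibniz rule is the
homotopy identity (the terms in `u` cancel), and all triple products in `P` vanish because `lam ∘ ρ
= 0` and `ρ² = 0`. This is `isDGA_trivialExtensionMul`.

To find `ρ`, take `t ∈ I` and `u ∈ F₁` with `lam(u) = t`. On the resolution of `I`, multiplication
by `t` is homotopic to `x ↦ lam(x) u`, by some `τ`. Then `ρ = τ∂τ` is a homotopy of the same kind
for `t²`, and it squares to zero (`IsIdealResolution.exists_squareZeroHomotopy`). So `s = t²` works
for any nonzero homogeneous `t ∈ I`, and `s = 1` if `I = 0`.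

For a monomial ideal with lcm `x^L` take `t = x^L`. All generators of `P` have degrees between `L`
and `2L` (`IsIdealResolution.deg_bounds`), so every entry of the homotopy for `t²` has degree at
least `L + 2L - 2L = L`. Hence it is divisible by `t`, and the quotient is a square-zero homotopy
for `t` itself.

Everything is done over a ring graded by an abelian group; a local ring gets the trivial grading by
`Unit`. Regularity enters through the fact that a regular local ring is a Noetherian domain. Minimal
resolutions exist by iterated covers by minimal homogeneous generators, which needs only that
elements outside `𝔪` have invertible degree-zero part. -/

/-! ### Regular local rings are domains. -/

open IsLocalRing in
/-- If `x ∈ 𝔪 \ 𝔪²`, then `x` can be exchanged against one of the elements of a finite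
generating set of `𝔪`. -/
theorem IsLocalRing.exists_span_insert_eq_maximalIdeal {R : Type*} [CommRing R] [IsLocalRing R]
    {s : Finset R} (hs : Ideal.span (s : Set R) = maximalIdeal R) {x : R}
    (hx : x ∈ maximalIdeal R) (hx2 : x ∉ maximalIdeal R ^ 2) :
    ∃ t : Finset R, t.card + 1 = s.card ∧
      Ideal.span (insert x (t : Set R)) = maximalIdeal R := by
  classical
  have hxs := hx
  rw [← hs, Ideal.span, Submodule.mem_span_finset] at hxs
  obtain ⟨f, -, hf⟩ := hxs
  have hmem : ∀ i ∈ s, i ∈ maximalIdeal R := fun i hi => hs ▸ Ideal.subset_span hi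
  obtain ⟨i, his, hi⟩ : ∃ i ∈ s, f i ∉ maximalIdeal R := by
    by_contra! h
    refine hx2 (hf ▸ Ideal.sum_mem _ fun i hi => ?_)
    rw [pow_two, smul_eq_mul]
    exact Ideal.mul_mem_mul (h i hi) (hmem i hi)
  refine ⟨s.erase i, Finset.card_erase_add_one his, le_antisymm ?_ ?_⟩
  · refine Ideal.span_le.2 (Set.insert_subset hx fun j hj => hmem j (Finset.mem_of_mem_erase hj))
  · rw [← hs, Ideal.span_le]
    intro j hj
    rcases eq_or_ne j i with rfl | hji
    · have hu : IsUnit (f j) := by simpa using hi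
      rw [← Finset.add_sum_erase s _ his] at hf
      have h1 : f j * j ∈ Ideal.span (insert x ((s.erase j : Finset R) : Set R)) := by
        have : f j * j = x - ∑ k ∈ s.erase j, f k • k := by
          rw [← hf]; simp
        rw [this]
        refine Ideal.sub_mem _ (Ideal.subset_span (Set.mem_insert _ _))
          (Ideal.sum_mem _ fun k hk => Ideal.mul_mem_left _ _
            (Ideal.subset_span (Set.mem_insert_of_mem _ hk)))
      exact (Ideal.unit_mul_mem_iff_mem _ hu).1 h1
    · exact Ideal.subset_span (Set.mem_insert_of_mem _ (by simpa using ⟨hj, hji⟩))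

-- Induction on the dimension. Choose `x ∈ 𝔪 \ 𝔪²` outside all minimal primes. Then `R/(x)` is
-- regular of dimension one less, so `(x)` is prime. A minimal prime `p ⊆ (x)` satisfies `p = x p`
-- because `x ∉ p`, hence `p = 0` by Nakayama.
open IsLocalRing in
theorem IsRegularLocalRing.isDomain_of_spanFinrank (d : ℕ) : ∀ (R : Type u) [CommRing R]
    [IsRegularLocalRing R], (maximalIdeal R).spanFinrank = d → IsDomain R := by
  induction d with
  | zero =>
    intro R _ _ h
    have hbot : maximalIdeal R = ⊥ :=
      (Submodule.spanFinrank_eq_zero_iff_eq_bot (IsNoetherian.noetherian _)).1 h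
    exact (IsLocalRing.isField_iff_maximalIdeal_eq.2 hbot).isDomain
  | succ d ih =>
    intro R _ _ h
    have hdim : ((d + 1 : ℕ) : WithBot ℕ∞) = ringKrullDim R := by
      rw [← h, IsRegularLocalRing.spanFinrank_maximalIdeal]
    have hne : maximalIdeal R ≠ ⊥ := fun hb => by
      rw [hb, Submodule.spanFinrank_bot] at h; omega
    have hnsq : ¬ maximalIdeal R ≤ maximalIdeal R ^ 2 := by
      intro hle
      refine hne (Submodule.eq_bot_of_le_smul_of_le_jacobson_bot (maximalIdeal R) _
        (IsNoetherian.noetherian _) ?_ (IsLocalRing.maximalIdeal_le_jacobson _))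
      rwa [smul_eq_mul, ← pow_two]
    have hnmin : ∀ p ∈ minimalPrimes R, ¬ maximalIdeal R ≤ p := by
      intro p hp hle
      have : p.IsPrime := hp.1.1
      have hpm : p = maximalIdeal R := le_antisymm (le_maximalIdeal this.ne_top) hle
      have h0 : (maximalIdeal R).height = 0 := by
        rw [← hpm]; exact Ideal.height_eq_zero_iff.2 hp
      have := IsLocalRing.maximalIdeal_height_eq_ringKrullDim (R := R)
      rw [h0, ← hdim] at this
      norm_cast at this
    obtain ⟨x, hx, hx2, hxp⟩ : ∃ x ∈ maximalIdeal R, x ∉ maximalIdeal R ^ 2 ∧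
        ∀ p ∈ minimalPrimes R, x ∉ p := by
      by_contra! hcon
      have hsub : (maximalIdeal R : Set R) ⊆
          ⋃ p ∈ insert (maximalIdeal R ^ 2) (minimalPrimes R), (p : Set R) := by
        intro x hx
        by_cases hx2 : x ∈ maximalIdeal R ^ 2
        · exact Set.mem_biUnion (Set.mem_insert _ _) hx2
        · obtain ⟨p, hp, hxp⟩ := hcon x hx hx2
          exact Set.mem_biUnion (Set.mem_insert_of_mem _ hp) hxp
      have hfin : (insert (maximalIdeal R ^ 2) (minimalPrimes R)).Finite :=
        (minimalPrimes.finite_of_isNoetherianRing R).insert _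
      -- Prime avoidance tolerates two ideals that need not be prime; `𝔪²` fills both places.
      obtain ⟨p, hp, hle⟩ := (Ideal.subset_union_prime_finite hfin (f := id)
        (maximalIdeal R ^ 2) (maximalIdeal R ^ 2) (fun p hp hp1 _ =>
          ((Set.mem_insert_iff.1 hp).resolve_left hp1).1.1)).1 hsub
      rcases Set.mem_insert_iff.1 hp with rfl | hp
      · exact hnsq hle
      · exact hnmin p hp hle
    obtain ⟨s, hs1, hs2⟩ := Submodule.FG.exists_span_finset_card_eq_spanFinrank
      (IsNoetherian.noetherian (maximalIdeal R))
    obtain ⟨t, ht1, ht2⟩ := exists_span_insert_eq_maximalIdeal hs2 hx hx2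
    have hxtop : Ideal.span {x} ≠ ⊤ := fun htop =>
      (maximalIdeal.isMaximal R).ne_top (top_le_iff.1 (htop ▸ (Ideal.span_singleton_le_iff_mem _).2 hx))
    have : Nontrivial (R ⧸ Ideal.span {x}) := Ideal.Quotient.nontrivial_iff.2 hxtop
    have : IsLocalRing (R ⧸ Ideal.span {x}) :=
      .of_surjective' (Ideal.Quotient.mk _) Ideal.Quotient.mk_surjective
    have hmax : maximalIdeal (R ⧸ Ideal.span {x}) =
        Ideal.span (Ideal.Quotient.mk (Ideal.span {x}) '' t) := by
      rw [← IsLocalRing.map_maximalIdeal_of_surjective _ (Ideal.Quotient.mk_surjective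
        (I := Ideal.span {x})), ← ht2, Ideal.map_span, Set.image_insert_eq, Ideal.span_insert]
      simp
    have hle : (maximalIdeal (R ⧸ Ideal.span {x})).spanFinrank ≤ d := by
      rw [hmax]
      refine (Submodule.spanFinrank_span_le_ncard_of_finite (t.finite_toSet.image _)).trans
        ((Set.ncard_image_le t.finite_toSet).trans ?_)
      rw [Set.ncard_coe_finset]
      omega
    have hdle : (d : WithBot ℕ∞) ≤ ringKrullDim (R ⧸ Ideal.span {x}) := by
      have := ringKrullDim_le_ringKrullDim_quotient_add_encard ({x} : Set R)
        (by simpa [IsLocalRing.ringJacobson_eq_maximalIdeal] using hx)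
      rw [← hdim] at this
      simp only [Set.encard_singleton, Nat.cast_add, Nat.cast_one] at this
      exact (ENat.WithBot.add_le_add_one_right_iff).1 this
    -- The maximal ideal of the quotient needs at most `d` generators, and the dimension drops by at
    -- most one.
    have hreg : IsRegularLocalRing (R ⧸ Ideal.span {x}) :=
      .of_spanFinrank_maximalIdeal_le _ (le_trans (by exact_mod_cast hle) hdle)
    have hprime : (Ideal.span {x}).IsPrime := by
      rw [← Ideal.Quotient.isDomain_iff_prime]
      refine ih _ (le_antisymm hle ?_)
      rw [← IsRegularLocalRing.spanFinrank_maximalIdeal] at hdle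
      exact_mod_cast hdle
    obtain ⟨p, hp, hpx⟩ := Ideal.exists_minimalPrimes_le (I := ⊥) (J := Ideal.span {x}) bot_le
    have hpp : p.IsPrime := hp.1.1
    have hpbot : p = ⊥ := by
      refine Submodule.eq_bot_of_le_smul_of_le_jacobson_bot (Ideal.span {x}) _
        (IsNoetherian.noetherian _) (fun y hy => ?_)
        ((le_maximalIdeal hxtop).trans (IsLocalRing.maximalIdeal_le_jacobson _))
      obtain ⟨z, rfl⟩ := Ideal.mem_span_singleton'.1 (hpx hy)
      rw [mul_comm]
      exact Ideal.mul_mem_mul (Ideal.mem_span_singleton_self x)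
        ((hpp.mem_or_mem hy).resolve_right (hxp p hp))
    have : (⊥ : Ideal R).IsPrime := hpbot ▸ hpp
    exact IsDomain.of_bot_isPrime R

theorem IsRegularLocalRing.isDomain (R : Type u) [CommRing R] [IsRegularLocalRing R] :
    IsDomain R :=
  isDomain_of_spanFinrank _ R rfl

/-! ### Recognizing internal direct sums. -/

section Internal

/-- A family of additive subobjects which span and admit compatible projections is an internal
direct sum decomposition. -/
theorem DirectSum.isInternal_of_proj {ι M σ : Type*} [DecidableEq ι] [AddCommGroup M]
    [SetLike σ M] [AddSubgroupClass σ M] (G : ι → σ) (p : ι → M →+ M)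
    (hp : ∀ i, ∀ x ∈ G i, p i x = x) (hp' : ∀ i j, i ≠ j → ∀ x ∈ G i, p j x = 0)
    (hG : ∀ x : M, x ∈ AddSubgroup.closure (⋃ i, (G i : Set M))) :
    DirectSum.IsInternal G := by
  refine ⟨?_, fun x => ?_⟩
  · rw [injective_iff_map_eq_zero]
    intro x hx
    have key : ∀ (y : DirectSum ι fun i => G i) (j : ι),
        p j (DirectSum.coeAddMonoidHom G y) = y j := by
      intro y j
      induction y using DirectSum.induction_on with
      | zero => simp
      | of i y =>
        rw [DirectSum.coeAddMonoidHom_of]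
        rcases eq_or_ne i j with rfl | hij
        · rw [DirectSum.of_eq_same, hp _ _ y.2]
        · rw [DirectSum.of_eq_of_ne _ _ _ hij.symm, hp' _ _ hij _ y.2]; rfl
      | add y z hy hz => simp [hy, hz]
    ext j
    rw [← key x j, hx]; simp
  · change x ∈ (DirectSum.coeAddMonoidHom G).range
    refine (AddSubgroup.closure_le _).2 ?_ (hG x)
    intro y hy
    obtain ⟨i, hi⟩ := Set.mem_iUnion.1 hy
    exact ⟨DirectSum.of (fun i => G i) i ⟨y, hi⟩, DirectSum.coeAddMonoidHom_of _ _ _⟩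

end Internal

/-! ### Gradings of a free module given by degrees of a basis. -/

section HomogeneousPart

open DirectSum

variable {S F A σ ι : Type*} [CommRing S] [AddCommGroup F] [Module S F] [AddCommGroup A]
  [SetLike σ S] [AddSubgroupClass σ S] (𝒜 : A → σ)

/-- The homogeneous elements of degree `a` of a free module over a graded ring, with a basis
whose elements have prescribed degrees. -/
def homogeneousPart (b : Module.Basis ι S F) (deg : ι → A) (a : A) : AddSubgroup F where
  carrier := {x | ∀ i, b.repr x i ∈ 𝒜 (a - deg i)}
  add_mem' hx hy i := by simpa using add_mem (hx i) (hy i)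
  zero_mem' i := by simp
  neg_mem' hx i := by simpa using hx i

variable {𝒜} {b : Module.Basis ι S F} {deg : ι → A}

theorem mem_homogeneousPart {a : A} {x : F} :
    x ∈ homogeneousPart 𝒜 b deg a ↔ ∀ i, b.repr x i ∈ 𝒜 (a - deg i) := Iff.rfl

variable [DecidableEq A] (𝒜) [GradedRing 𝒜]

theorem basis_mem_homogeneousPart (b : Module.Basis ι S F) (deg : ι → A) (i : ι) :
    b i ∈ homogeneousPart 𝒜 b deg (deg i) := by
  classical
  intro j
  rw [Module.Basis.repr_self, Finsupp.single_apply]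
  split_ifs with h
  · subst h; simpa using SetLike.GradedOne.one_mem (A := 𝒜)
  · exact zero_mem _

variable {𝒜} in
theorem smul_mem_homogeneousPart {a c : A} {r : S} {x : F} (hr : r ∈ 𝒜 a)
    (hx : x ∈ homogeneousPart 𝒜 b deg c) : r • x ∈ homogeneousPart 𝒜 b deg (a + c) := by
  intro i
  rw [map_smul, Finsupp.smul_apply, smul_eq_mul, add_sub_assoc]
  exact SetLike.GradedMul.mul_mem hr (hx i)

/-- The projection to the homogeneous component of degree `a`. -/
noncomputable def homogeneousProj (b : Module.Basis ι S F) (deg : ι → A) (a : A) : F →+ F :=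
  (Finsupp.liftAddHom fun i =>
    ((LinearMap.toSpanSingleton S F (b i)).toAddMonoidHom.comp
      (GradedRing.proj 𝒜 (a - deg i)))).comp b.repr.toLinearMap.toAddMonoidHom

theorem repr_homogeneousProj (b : Module.Basis ι S F) (deg : ι → A) (a : A) (x : F) (i : ι) :
    b.repr (homogeneousProj 𝒜 b deg a x) i = decompose 𝒜 (b.repr x i) (a - deg i) := by
  classical
  obtain ⟨f, rfl⟩ := b.repr.symm.surjective x
  induction f using Finsupp.induction_linear with
  | zero => simp
  | add f g hf hg => simp only [map_add, Finsupp.add_apply, hf, hg, decompose_add,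
      DirectSum.add_apply, AddMemClass.coe_add]
  | single j r =>
    have : homogeneousProj 𝒜 b deg a (b.repr.symm (Finsupp.single j r)) =
        (decompose 𝒜 r (a - deg j) : S) • b j := by
      simp [homogeneousProj, GradedRing.proj_apply]
    rw [this]
    simp only [map_smul, Module.Basis.repr_self, LinearEquiv.apply_symm_apply, Finsupp.smul_apply,
      Finsupp.single_apply, smul_eq_mul]
    split_ifs with h
    · subst h; simp
    · simp

theorem homogeneousProj_mem (b : Module.Basis ι S F) (deg : ι → A) (a : A) (x : F) :
    homogeneousProj 𝒜 b deg a x ∈ homogeneousPart 𝒜 b deg a := by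
  intro i
  rw [repr_homogeneousProj]
  exact SetLike.coe_mem _

variable {𝒜}

theorem decompose_mul_right {r q : S} {c : A} (hq : q ∈ 𝒜 c) (a : A) :
    (decompose 𝒜 (r * q) a : S) = decompose 𝒜 r (a - c) * q := by
  rw [← coe_decompose_mul_add_of_right_mem 𝒜 hq, sub_add_cancel]

/-- Reduces taking the degree `a` part of a relation among homogeneous elements to taking components
of its coefficients. -/
theorem homogeneousProj_smul {c : A} {x : F} (hx : x ∈ homogeneousPart 𝒜 b deg c) (r : S)
    (a : A) : homogeneousProj 𝒜 b deg a (r • x) = (decompose 𝒜 r (a - c) : S) • x := by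
  refine b.ext_elem fun i => ?_
  rw [repr_homogeneousProj, map_smul, Finsupp.smul_apply, smul_eq_mul, decompose_mul_right (hx i),
    map_smul, Finsupp.smul_apply, smul_eq_mul]
  rw [sub_sub_sub_cancel_right]

theorem homogeneousProj_of_mem {a : A} {x : F} (hx : x ∈ homogeneousPart 𝒜 b deg a) :
    homogeneousProj 𝒜 b deg a x = x := by
  refine b.ext_elem fun i => ?_
  rw [repr_homogeneousProj, decompose_of_mem_same 𝒜 (hx i)]

theorem homogeneousProj_of_mem_ne {a c : A} (h : c ≠ a) {x : F}
    (hx : x ∈ homogeneousPart 𝒜 b deg c) : homogeneousProj 𝒜 b deg a x = 0 := by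
  refine b.ext_elem fun i => ?_
  rw [repr_homogeneousProj, decompose_of_mem_ne 𝒜 (hx i) (by simpa using h)]
  simp

variable (𝒜)

theorem mem_closure_homogeneousPart (b : Module.Basis ι S F) (deg : ι → A) (x : F) :
    x ∈ AddSubgroup.closure (⋃ a, (homogeneousPart 𝒜 b deg a : Set F)) := by
  have key : ∀ (r : S) (i : ι),
      r • b i ∈ AddSubgroup.closure (⋃ a, (homogeneousPart 𝒜 b deg a : Set F)) := by
    intro r i
    induction r using Decomposition.inductionOn 𝒜 with
    | zero => simp
    | @homogeneous a r =>
      exact AddSubgroup.subset_closure (Set.mem_iUnion.2 ⟨_,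
        smul_mem_homogeneousPart r.2 (basis_mem_homogeneousPart 𝒜 b deg i)⟩)
    | add r q hr hq => rw [add_smul]; exact add_mem hr hq
  rw [← b.linearCombination_repr x, Finsupp.linearCombination_apply]
  exact sum_mem fun i _ => key _ i

theorem isInternal_homogeneousPart (b : Module.Basis ι S F) (deg : ι → A) :
    IsInternal (homogeneousPart 𝒜 b deg) :=
  isInternal_of_proj _ (homogeneousProj 𝒜 b deg) (fun _ _ hx => homogeneousProj_of_mem hx)
    (fun _ _ h _ hx => homogeneousProj_of_mem_ne h hx) (mem_closure_homogeneousPart 𝒜 b deg)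

theorem homogeneous_induction (b : Module.Basis ι S F) (deg : ι → A) {p : F → Prop}
    (h0 : p 0) (hadd : ∀ x y, p x → p y → p (x + y))
    (hom : ∀ a, ∀ x ∈ homogeneousPart 𝒜 b deg a, p x) (x : F) : p x := by
  refine AddSubgroup.closure_induction'' (p := fun x _ => p x) ?_ ?_ h0
    (fun x y _ _ => hadd x y) (mem_closure_homogeneousPart 𝒜 b deg x)
  · intro y hy
    obtain ⟨a, ha⟩ := Set.mem_iUnion.1 hy
    exact hom a y ha
  · intro y hy
    obtain ⟨a, ha⟩ := Set.mem_iUnion.1 hy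
    exact hom a _ (neg_mem ha)

theorem exists_sum_homogeneousProj (b : Module.Basis ι S F) (deg : ι → A) (x : F) :
    ∃ t : Finset A, ∀ t', t ⊆ t' → ∑ a ∈ t', homogeneousProj 𝒜 b deg a x = x := by
  classical
  induction x using homogeneous_induction 𝒜 b deg with
  | h0 => simp
  | hadd x y hx hy =>
    obtain ⟨t, ht⟩ := hx
    obtain ⟨u, hu⟩ := hy
    refine ⟨t ∪ u, fun t' h => ?_⟩
    simp only [map_add, Finset.sum_add_distrib]
    rw [ht t' (Finset.union_subset_left h), hu t' (Finset.union_subset_right h)]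
  | hom a x hx =>
    refine ⟨{a}, fun t' h => ?_⟩
    rw [Finset.sum_eq_single a, homogeneousProj_of_mem hx]
    · intro c _ hc
      exact homogeneousProj_of_mem_ne hc.symm hx
    · intro ha
      exact absurd (h (Finset.mem_singleton_self a)) ha

/-- An internal grading compatible with the grading of the ring is determined by the degrees of
a homogeneous basis. -/
theorem eq_homogeneousPart {𝓖 : A → AddSubgroup F} (hint : IsInternal 𝓖)
    (hsmul : ∀ (a c : A) (r : S) (x : F), r ∈ 𝒜 a → x ∈ 𝓖 c → r • x ∈ 𝓖 (a + c))
    (b : Module.Basis ι S F) (deg : ι → A) (hb : ∀ i, b i ∈ 𝓖 (deg i)) :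
    𝓖 = homogeneousPart 𝒜 b deg := by
  -- An independent family has no room above a family that already spans, so one inclusion in each
  -- degree suffices.
  refine ((iSupIndep.le_iff_eq_of_iSup_eq_top (IsInternal.addSubgroup_iSupIndep hint) ?_).1
    fun a x hx => ?_).symm
  · refine top_le_iff.1 fun x _ => ?_
    have := mem_closure_homogeneousPart 𝒜 b deg x
    rwa [AddSubgroup.closure_iUnion, iSup_congr fun i => AddSubgroup.closure_eq _] at this
  · rw [← b.linearCombination_repr x, Finsupp.linearCombination_apply]
    refine sum_mem fun i _ => ?_
    have := hsmul _ _ _ _ (hx i) (hb i)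
    rwa [sub_add_cancel] at this

variable {𝒜}

/-- The component of `r * q` in degree `a + c` is `r_a * q`; it is all of `r * q`, and `q` cancels.
-/
theorem mem_of_mul_mem [IsDomain S] {a c : A} {r q : S} (hq : q ∈ 𝒜 c) (hq0 : q ≠ 0)
    (h : r * q ∈ 𝒜 (a + c)) : r ∈ 𝒜 a := by
  have h1 := coe_decompose_mul_add_of_right_mem 𝒜 hq (i := a) (a := r)
  rw [decompose_of_mem_same 𝒜 h] at h1
  rw [mul_right_cancel₀ hq0 h1]
  exact SetLike.coe_mem _

theorem mem_homogeneousPart_of_smul_mem [IsDomain S] {a c : A} {q : S} {x : F} (hq : q ∈ 𝒜 c)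
    (hq0 : q ≠ 0) (h : q • x ∈ homogeneousPart 𝒜 b deg (a + c)) :
    x ∈ homogeneousPart 𝒜 b deg a := by
  intro i
  refine mem_of_mul_mem (c := c) hq hq0 ?_
  have := h i
  rwa [map_smul, Finsupp.smul_apply, smul_eq_mul, mul_comm, add_sub_right_comm] at this

theorem mem_of_smul_mem_homogeneousPart [IsDomain S] {a c : A} {r : S} {x : F}
    (hx : x ∈ homogeneousPart 𝒜 b deg c) (hx0 : x ≠ 0)
    (h : r • x ∈ homogeneousPart 𝒜 b deg (a + c)) : r ∈ 𝒜 a := by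
  obtain ⟨i, hi⟩ : ∃ i, b.repr x i ≠ 0 := by
    by_contra! h
    exact hx0 (b.ext_elem fun i => by simp [h i])
  refine mem_of_mul_mem (hx i) hi ?_
  have := h i
  rwa [map_smul, Finsupp.smul_apply, smul_eq_mul, add_sub_assoc] at this

section LinearMap

variable {M κ : Type*} [AddCommGroup M] [Module S M] {b' : Module.Basis κ S M} {deg' : κ → A}

theorem map_mem_homogeneousPart {f : F →ₗ[S] M} {e : A}
    (hf : ∀ i, f (b i) ∈ homogeneousPart 𝒜 b' deg' (deg i + e)) {a : A} {x : F}
    (hx : x ∈ homogeneousPart 𝒜 b deg a) : f x ∈ homogeneousPart 𝒜 b' deg' (a + e) := by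
  rw [← b.linearCombination_repr x, Finsupp.linearCombination_apply, Finsupp.sum, map_sum]
  refine sum_mem fun i _ => ?_
  have := smul_mem_homogeneousPart (hx i) (hf i)
  rwa [← add_assoc, sub_add_cancel, ← map_smul] at this

theorem homogeneousProj_map {f : F →ₗ[S] M}
    (hf : ∀ a, ∀ x ∈ homogeneousPart 𝒜 b deg a, f x ∈ homogeneousPart 𝒜 b' deg' a) (a : A)
    (x : F) : homogeneousProj 𝒜 b' deg' a (f x) = f (homogeneousProj 𝒜 b deg a x) := by
  induction x using homogeneous_induction 𝒜 b deg with
  | h0 => simp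
  | hadd x y hx hy => simp [hx, hy]
  | hom c x hx =>
    rcases eq_or_ne c a with rfl | h
    · rw [homogeneousProj_of_mem hx, homogeneousProj_of_mem (hf _ _ hx)]
    · rw [homogeneousProj_of_mem_ne h hx, homogeneousProj_of_mem_ne h (hf _ _ hx), map_zero]

end LinearMap

end HomogeneousPart

/-! ### Homological degrees read off from a basis. -/

section BasisComponent

open DirectSum

variable {S F : Type*} [CommRing S] [AddCommGroup F] [Module S F] {m : ℕ → ℕ}
  (b : Module.Basis (Σ i, Fin (m i)) S F)

/-- The span of the `i`-th group of elements of a basis which is divided into groups. -/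
def basisComponent (i : ℕ) : Submodule S F where
  carrier := {x | ∀ k, k.1 ≠ i → b.repr x k = 0}
  add_mem' hx hy k hk := by simp [hx k hk, hy k hk]
  zero_mem' k _ := by simp
  smul_mem' r x hx k hk := by simp [hx k hk]

variable {b}

theorem basis_mem_basisComponent (b : Module.Basis (Σ i, Fin (m i)) S F) (k : Σ i, Fin (m i)) :
    b k ∈ basisComponent b k.1 := by
  intro l hl
  rw [b.repr_self, Finsupp.single_apply, if_neg (by rintro rfl; exact hl rfl)]

theorem basisComponent_eq_span (b : Module.Basis (Σ i, Fin (m i)) S F) (i : ℕ) :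
    basisComponent b i = Submodule.span S (Set.range fun j : Fin (m i) => b ⟨i, j⟩) := by
  refine le_antisymm (fun x hx => ?_) (Submodule.span_le.2 ?_)
  · rw [← b.linearCombination_repr x, Finsupp.linearCombination_apply]
    refine sum_mem fun k hk => Submodule.smul_mem _ _ (Submodule.subset_span ?_)
    obtain ⟨i', j⟩ := k
    obtain rfl : i' = i := by
      by_contra h
      exact (Finsupp.mem_support_iff.1 hk) (hx _ h)
    exact ⟨j, rfl⟩
  · rintro _ ⟨j, rfl⟩
    exact basis_mem_basisComponent b ⟨i, j⟩

/-- The basis elements in the `i`-th group as a basis of their span. -/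
noncomputable def basisComponentBasis (b : Module.Basis (Σ i, Fin (m i)) S F) (i : ℕ) :
    Module.Basis (Fin (m i)) S (basisComponent b i) :=
  (Module.Basis.span (b.linearIndependent.comp (fun j : Fin (m i) => (⟨i, j⟩ : Σ i, Fin (m i)))
    fun _ _ h => by simpa using h)).map (LinearEquiv.ofEq _ _ (basisComponent_eq_span b i).symm)

theorem coe_basisComponentBasis (b : Module.Basis (Σ i, Fin (m i)) S F) (i : ℕ)
    (j : Fin (m i)) : (basisComponentBasis b i j : F) = b ⟨i, j⟩ := by
  simp [basisComponentBasis, Module.Basis.span_apply]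

theorem eqOn_basisComponent {M : Type*} [AddCommGroup M] [Module S M] {f g : F →ₗ[S] M} {i : ℕ}
    (h : ∀ j, f (b ⟨i, j⟩) = g (b ⟨i, j⟩)) {x : F} (hx : x ∈ basisComponent b i) :
    f x = g x := by
  rw [basisComponent_eq_span] at hx
  exact LinearMap.eqOn_span (by rintro _ ⟨j, rfl⟩; exact h j) hx

theorem linearMap_ext_basisComponent {M : Type*} [AddCommGroup M] [Module S M] {f g : F →ₗ[S] M}
    (h : ∀ i, ∀ x ∈ basisComponent b i, f x = g x) : f = g :=
  b.ext fun k => h k.1 _ (basis_mem_basisComponent b k)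

/-- Multiplication by the scalar `c i` on the `i`-th component. -/
noncomputable def componentScale (b : Module.Basis (Σ i, Fin (m i)) S F) (c : ℕ → S) :
    F →ₗ[S] F :=
  b.constr S fun k => c k.1 • b k

theorem componentScale_of_mem (c : ℕ → S) {i : ℕ} {x : F} (hx : x ∈ basisComponent b i) :
    componentScale b c x = c i • x :=
  eqOn_basisComponent (g := c i • LinearMap.id) (fun j => by simp [componentScale]) hx

theorem repr_componentScale (c : ℕ → S) (x : F) (k : Σ i, Fin (m i)) :
    b.repr (componentScale b c x) k = c k.1 * b.repr x k := by
  have : (Finsupp.lapply k ∘ₗ b.repr.toLinearMap) ∘ₗ componentScale b c =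
      c k.1 • (Finsupp.lapply k ∘ₗ b.repr.toLinearMap) := by
    refine b.ext fun l => ?_
    by_cases h : l = k
    · subst h; simp [componentScale]
    · simp [componentScale, h]
  simpa using LinearMap.congr_fun this x

theorem componentScale_single_mem (i : ℕ) (x : F) :
    componentScale b (Pi.single i 1) x ∈ basisComponent b i := by
  intro k hk
  rw [repr_componentScale, Pi.single_eq_of_ne hk, zero_mul]

theorem isInternal_basisComponent (b : Module.Basis (Σ i, Fin (m i)) S F) :
    IsInternal (basisComponent b) := by
  refine isInternal_of_proj _ (fun i => (componentScale b (Pi.single i 1)).toAddMonoidHom)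
    ?_ ?_ ?_
  · intro i x hx
    simpa using componentScale_of_mem (Pi.single i 1) hx
  · intro i j hij x hx
    simpa [Pi.single_eq_of_ne hij] using componentScale_of_mem (Pi.single j 1) hx
  · intro x
    rw [← b.linearCombination_repr x, Finsupp.linearCombination_apply]
    exact sum_mem fun k _ => AddSubgroup.subset_closure (Set.mem_iUnion.2
      ⟨k.1, Submodule.smul_mem _ _ (basis_mem_basisComponent b k)⟩)

/-- With a basis adapted to the homological grading, membership in `F_i` becomes vanishing of
coordinates. Statements about an arbitrary resolution are reduced to this form. -/
theorem exists_eq_basisComponent {𝓕 : ℕ → Submodule S F} (hint : IsInternal 𝓕)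
    (v : ∀ i, Module.Basis (Fin (m i)) S (𝓕 i)) :
    𝓕 = basisComponent (hint.collectedBasis v) := by
  ext i x
  refine ⟨fun hx k hk => hint.collectedBasis_repr_of_mem_ne v hk.symm hx, fun hx => ?_⟩
  rw [← (hint.collectedBasis v).linearCombination_repr x, Finsupp.linearCombination_apply]
  refine sum_mem fun k hk => Submodule.smul_mem _ _ ?_
  have : k.1 = i := by
    by_contra h
    exact (Finsupp.mem_support_iff.1 hk) (hx _ h)
  exact this ▸ hint.collectedBasis_mem v k

end BasisComponent

/-! ### Nakayama-type facts for basis elements. -/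

section Minimal

variable {S F ι : Type*} [CommRing S] [AddCommGroup F] [Module S F]

theorem Module.Basis.mem_smul_top_iff (b : Module.Basis ι S F) {𝔪 : Ideal S} {x : F} :
    x ∈ 𝔪 • (⊤ : Submodule S F) ↔ ∀ i, b.repr x i ∈ 𝔪 := by
  refine ⟨fun hx i => ?_, fun hx => ?_⟩
  · refine Submodule.smul_induction_on hx (fun r hr y _ => ?_) fun y z hy hz => ?_
    · simpa using Ideal.mul_mem_right _ _ hr
    · simpa using add_mem hy hz
  · rw [← b.linearCombination_repr x, Finsupp.linearCombination_apply]
    exact sum_mem fun i _ => Submodule.smul_mem_smul (hx i) trivial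

/-- Otherwise the `i`-th coordinate `1` would lie in `𝔪`. Contradictions to minimality below are
obtained in this form. -/
theorem Module.Basis.sub_notMem_smul_top (b : Module.Basis ι S F) {𝔪 : Ideal S} (h𝔪 : 𝔪 ≠ ⊤)
    (i : ι) {x : F} (hx : x ∈ 𝔪 • (⊤ : Submodule S F)) :
    b i - x ∉ 𝔪 • (⊤ : Submodule S F) := by
  intro h
  have := (b.mem_smul_top_iff.1 (add_mem h hx)) i
  rw [sub_add_cancel, b.repr_self, Finsupp.single_eq_same] at this
  exact h𝔪 ((Ideal.eq_top_iff_one _).2 this)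

end Minimal

/-! ### Division by an injective map. -/

section Lift

variable {S M N P : Type*} [CommRing S] [AddCommGroup M] [Module S M] [AddCommGroup N]
  [Module S N] [AddCommGroup P] [Module S P]

/-- Turns maps into `S • one` into the scalar-valued maps `π` and `lam`, and divides a homotopy by a
monomial. -/
theorem LinearMap.exists_comp_eq_of_injective {g : N →ₗ[S] P} (hg : Function.Injective g)
    (f : M →ₗ[S] P) (h : ∀ x, ∃ y, g y = f x) : ∃ l : M →ₗ[S] N, ∀ x, g (l x) = f x :=
  ⟨(LinearEquiv.ofInjective g hg).symm.toLinearMap ∘ₗ f.codRestrict (LinearMap.range g) h,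
    fun x => by
      have := (LinearEquiv.ofInjective g hg).apply_symm_apply
        (f.codRestrict (LinearMap.range g) h x)
      exact congrArg Subtype.val this⟩

end Lift

/-! ### The multiplication defined by a square-zero homotopy. -/

section TrivialExtension

variable {S F : Type*} [CommRing S] [AddCommGroup F] [Module S F]

/-- The multiplication on `F = S • one ⊕ F₊` in which the product of two elements `a`, `c` of
`F₊` is `lam a • ρ c + lam c • ρ (J a)`. -/
def trivialExtensionMul (one : F) (π lam : F →ₗ[S] S) (ρ J : F →ₗ[S] F) : F →ₗ[S] F →ₗ[S] F :=
  LinearMap.mk₂ S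
    -- The first three terms are the products with the components in `F₀`, the product of these
    -- components being counted once. `J` will be the sign `(-1)^i` on `F_i`.
    (fun a c => π a • c + π c • a - (π a * π c) • one + lam a • ρ c + lam c • ρ (J a))
    (fun _ _ _ => by simp only [map_add]; module)
    (fun _ _ _ => by simp only [map_smul, smul_eq_mul]; module)
    (fun _ _ _ => by simp only [map_add]; module)
    (fun _ _ _ => by simp only [map_smul, smul_eq_mul]; module)

theorem trivialExtensionMul_apply (one : F) (π lam : F →ₗ[S] S) (ρ J : F →ₗ[S] F) (a c : F) :
    trivialExtensionMul one π lam ρ J a c =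
      π a • c + π c • a - (π a * π c) • one + lam a • ρ c + lam c • ρ (J a) := rfl

/-- The Leibniz rule comes from the homotopy identities `hρ1` and `hρ2`; associativity comes from
`hρρ` and the vanishing of `lam` and `π` on the image of `ρ`. The products have the right degree
because `lam` is supported in degree `1`, where `ρ` supplies the missing shift. -/
theorem isDGA_trivialExtensionMul {m : ℕ → ℕ} {b : Module.Basis (Σ i, Fin (m i)) S F}
    {d : F →ₗ[S] F} {one : F} {π lam : F →ₗ[S] S} {ρ J : F →ₗ[S] F} {s : S} {u : F}
    (hspan : basisComponent b 0 = Submodule.span S {one})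
    (hd0 : ∀ x ∈ basisComponent b 0, d x = 0)
    (hd : ∀ i, ∀ x ∈ basisComponent b (i + 1), d x ∈ basisComponent b i)
    (hd1 : ∀ x ∈ basisComponent b 1, d x = (s * lam x) • one)
    (hπ1 : π one = 1) (hπ : ∀ i, ∀ x ∈ basisComponent b (i + 1), π x = 0)
    (hl0 : lam one = 0) (hl : ∀ i, ∀ x ∈ basisComponent b (i + 2), lam x = 0)
    (hld : ∀ x, lam (d x) = 0)
    (hJ : ∀ i, ∀ x ∈ basisComponent b i, J x = (-1 : S) ^ i • x)
    (hρ0 : ρ one = 0) (hρ : ∀ i, ∀ x ∈ basisComponent b (i + 1), ρ x ∈ basisComponent b (i + 2))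
    (hρρ : ∀ x, ρ (ρ x) = 0)
    (hρ1 : ∀ x ∈ basisComponent b 1, d (ρ x) = s • x - lam x • u)
    (hρ2 : ∀ i, ∀ x ∈ basisComponent b (i + 2), d (ρ x) + ρ (d x) = s • x) :
    IsDGA (basisComponent b) d one (trivialExtensionMul one π lam ρ J) := by
  have h0 : ∀ x ∈ basisComponent b 0, ∃ r : S, x = r • one := by
    intro x hx
    rw [hspan, Submodule.mem_span_singleton] at hx
    exact hx.imp fun _ => Eq.symm
  have hone : one ∈ basisComponent b 0 := hspan ▸ Submodule.mem_span_singleton_self one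
  have hJ1 : J one = one := by simpa using hJ 0 one hone
  have hmul : ∀ a c, π a = 0 → π c = 0 →
      trivialExtensionMul one π lam ρ J a c = lam a • ρ c + lam c • ρ (J a) := by
    intro a c ha hc
    simp [trivialExtensionMul_apply, ha, hc]
  have hone_mul : ∀ a, trivialExtensionMul one π lam ρ J one a = a := by
    intro a
    simp [trivialExtensionMul_apply, hπ1, hl0, hJ1, hρ0]
  have hmul_one : ∀ a, trivialExtensionMul one π lam ρ J a one = a := by
    intro a
    simp [trivialExtensionMul_apply, hπ1, hl0, hρ0]
  have hπρ : π ∘ₗ ρ = 0 := by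
    refine linearMap_ext_basisComponent (b := b) fun i x hx => ?_
    cases i with
    | zero => obtain ⟨r, rfl⟩ := h0 x hx; simp [hρ0]
    | succ i => exact hπ _ _ (hρ _ _ hx)
  have hlρ : lam ∘ₗ ρ = 0 := by
    refine linearMap_ext_basisComponent (b := b) fun i x hx => ?_
    cases i with
    | zero => obtain ⟨r, rfl⟩ := h0 x hx; simp [hρ0]
    | succ i => exact hl _ _ (hρ _ _ hx)
  have hJρ : ρ ∘ₗ J ∘ₗ ρ = 0 := by
    refine linearMap_ext_basisComponent (b := b) fun i x hx => ?_
    cases i with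
    | zero => obtain ⟨r, rfl⟩ := h0 x hx; simp [hρ0]
    | succ i => simp [hJ _ _ (hρ _ _ hx), hρρ]
  replace hπρ : ∀ x, π (ρ x) = 0 := LinearMap.congr_fun hπρ
  replace hlρ : ∀ x, lam (ρ x) = 0 := LinearMap.congr_fun hlρ
  replace hJρ : ∀ x, ρ (J (ρ x)) = 0 := LinearMap.congr_fun hJρ
  have hd1' : d one = 0 := hd0 one hone
  refine ⟨hone_mul, hmul_one, ?_, ?_, ?_, ?_⟩
  · intro i a ha c
    have key : d ∘ₗ trivialExtensionMul one π lam ρ J a =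
        trivialExtensionMul one π lam ρ J (d a) +
          (-1 : S) ^ i • (trivialExtensionMul one π lam ρ J a ∘ₗ d) := by
      refine linearMap_ext_basisComponent (b := b) fun j c hc => ?_
      simp only [LinearMap.comp_apply, LinearMap.add_apply, LinearMap.smul_apply]
      rcases j with _ | j
      · obtain ⟨r, rfl⟩ := h0 c hc
        simp [hmul_one, hd1']
      rcases i with _ | i
      · obtain ⟨r, rfl⟩ := h0 a ha
        simp [hone_mul, hd1']
      rw [hmul a c (hπ _ _ ha) (hπ _ _ hc)]
      -- Degree one is separated from degrees at least two, on both sides. If both factors have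
      -- degree one, the two terms `lam a * lam c • u` cancel; if both have degree at least two,
      -- every product involved is zero.
      rcases i with _ | i <;> rcases j with _ | j
      · rw [hd1 a ha, hd1 c hc, map_smul, map_smul, LinearMap.smul_apply, hone_mul, hmul_one,
          hJ _ _ ha, map_add, map_smul, map_smul, map_smul, map_smul, hρ1 _ ha, hρ1 _ hc]
        module
      · rw [hd1 a ha, map_smul, LinearMap.smul_apply, hone_mul, hl _ _ hc,
          hmul a _ (hπ _ _ ha) (hπ _ _ (hd _ _ hc)), hld, map_add, map_smul,
          eq_sub_of_add_eq (hρ2 _ _ hc)]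
        simp only [zero_smul, map_zero]
        module
      · rw [hd1 c hc, map_smul, hmul_one, hl _ _ ha,
          hmul _ c (hπ _ _ (hd _ _ ha)) (hπ _ _ hc), hld, hJ _ _ ha, hJ _ _ (hd _ _ ha), map_add,
          map_smul, map_smul, map_smul, map_smul, map_smul, eq_sub_of_add_eq (hρ2 _ _ ha)]
        simp only [zero_smul, pow_succ]
        module
      · rw [hl _ _ ha, hl _ _ hc, hmul _ c (hπ _ _ (hd _ _ ha)) (hπ _ _ hc),
          hmul a _ (hπ _ _ ha) (hπ _ _ (hd _ _ hc)), hl _ _ ha, hl _ _ hc, hld, hld]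
        simp
    exact LinearMap.congr_fun key c
  · intro i j a ha c hc
    rcases i with _ | i
    · obtain ⟨r, rfl⟩ := h0 a ha
      rw [map_smul, LinearMap.smul_apply, hone_mul, zero_add]
      exact Submodule.smul_mem _ _ hc
    rcases j with _ | j
    · obtain ⟨r, rfl⟩ := h0 c hc
      rw [map_smul, hmul_one]
      exact Submodule.smul_mem _ _ ha
    rw [hmul a c (hπ _ _ ha) (hπ _ _ hc), hJ _ _ ha, map_smul]
    refine add_mem ?_ ?_
    · rcases i with _ | i
      · convert Submodule.smul_mem _ (lam a) (hρ _ _ hc) using 2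
        omega
      · rw [hl _ _ ha, zero_smul]; exact zero_mem _
    · rcases j with _ | j
      · exact Submodule.smul_mem _ _ (Submodule.smul_mem _ _ (hρ _ _ ha))
      · rw [hl _ _ hc, zero_smul]; exact zero_mem _
  · intro i j a ha c hc
    rcases i with _ | i
    · obtain ⟨r, rfl⟩ := h0 a ha
      simp [hone_mul, hmul_one]
    rcases j with _ | j
    · obtain ⟨r, rfl⟩ := h0 c hc
      simp [hone_mul, hmul_one]
    rw [hmul a c (hπ _ _ ha) (hπ _ _ hc), hmul c a (hπ _ _ hc) (hπ _ _ ha), hJ _ _ ha,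
      hJ _ _ hc, map_smul, map_smul]
    rcases i with _ | i <;> rcases j with _ | j
    · module
    · rw [hl _ _ hc, zero_add, one_mul, smul_add]
      simp only [zero_smul, smul_zero, zero_add, add_zero]
      rw [smul_comm (lam a), smul_smul, ← pow_add, (Even.add_self _).neg_one_pow, one_smul]
    · rw [hl _ _ ha, zero_add, mul_one]
      module
    · rw [hl _ _ ha, hl _ _ hc]
      simp
  · intro a c e
    -- `π` is multiplicative, and `lam`, `ρ` and `ρ ∘ J` are derivations along `π`; associativity is
    -- then linear algebra.
    have hπm : ∀ a c, π (trivialExtensionMul one π lam ρ J a c) = π a * π c := by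
      intro a c
      simp [trivialExtensionMul_apply, hπ1, hπρ]
      ring
    have hlm : ∀ a c, lam (trivialExtensionMul one π lam ρ J a c) =
        π a * lam c + π c * lam a := by
      intro a c
      simp [trivialExtensionMul_apply, hl0, hlρ]
    have hρm : ∀ a c, ρ (trivialExtensionMul one π lam ρ J a c) = π a • ρ c + π c • ρ a := by
      intro a c
      simp [trivialExtensionMul_apply, hρ0, hρρ]
    have hρJm : ∀ a c, ρ (J (trivialExtensionMul one π lam ρ J a c)) =
        π a • ρ (J c) + π c • ρ (J a) := by
      intro a c
      simp [trivialExtensionMul_apply, hρ0, hJ1, hJρ]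
    rw [trivialExtensionMul_apply _ _ _ _ _ (trivialExtensionMul one π lam ρ J a c) e,
      trivialExtensionMul_apply _ _ _ _ _ a (trivialExtensionMul one π lam ρ J c e),
      hπm, hπm, hlm, hlm, hρm, hρJm, trivialExtensionMul_apply, trivialExtensionMul_apply]
    module

end TrivialExtension

theorem exists_seq_of_step {X : Type*} (Q : ℕ → X → Prop) (R : ℕ → X → X → Prop) {x₀ : X}
    (h0 : Q 0 x₀) (hs : ∀ n x, Q n x → ∃ y, Q (n + 1) y ∧ R n x y) :
    ∃ f : ℕ → X, f 0 = x₀ ∧ (∀ n, Q n (f n)) ∧ ∀ n, R n (f n) (f (n + 1)) := by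
  choose! g hg using hs
  let f : ℕ → X := fun n => Nat.rec x₀ (fun n x => g n x) n
  have hf : ∀ n, Q n (f n) := by
    intro n
    induction n with
    | zero => exact h0
    | succ n ih => exact (hg n _ ih).1
  exact ⟨f, rfl, hf, fun n => (hg n _ (hf n)).2⟩

/-! ### Square-zero homotopies on a resolution of an ideal. -/

section Contraction

open DirectSum

variable {S F A σ : Type*} [CommRing S] [AddCommGroup F] [Module S F] [AddCommGroup A]
  [SetLike σ S] [AddSubgroupClass σ S] {m : ℕ → ℕ}

/-- `d`, a differential of degree `-1` on `⨁ i ≥ 1, F i`, and `lam : F 1 → S`, which lowers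
degrees by `D`, form a graded free resolution of the ideal `I`. -/
structure IsIdealResolution (𝒜 : A → σ) (b : Module.Basis (Σ i, Fin (m i)) S F)
    (deg : (Σ i, Fin (m i)) → A) (d : F →ₗ[S] F) (D : A) (I : Ideal S) (lam : F →ₗ[S] S) :
    Prop where
  d_mem : ∀ i, ∀ x ∈ basisComponent b (i + 1), d x ∈ basisComponent b i
  d_hom : ∀ a, ∀ x ∈ homogeneousPart 𝒜 b deg a, d x ∈ homogeneousPart 𝒜 b deg a
  d_exact : ∀ i, ∀ x ∈ basisComponent b (i + 2), d x = 0 → ∃ y ∈ basisComponent b (i + 3), d y = x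
  lam_exact : ∀ x ∈ basisComponent b 1, lam x = 0 → ∃ y ∈ basisComponent b 2, d y = x
  d_d : ∀ x, d (d x) = 0
  lam_d : ∀ x, lam (d x) = 0
  lam_zero : ∀ x ∈ basisComponent b 0, lam x = 0
  lam_add_two : ∀ i, ∀ x ∈ basisComponent b (i + 2), lam x = 0
  lam_hom : ∀ a, ∀ x ∈ homogeneousPart 𝒜 b deg a, lam x ∈ 𝒜 (a - D)
  lam_mem : ∀ x, lam x ∈ I
  exists_lam : ∀ a, ∀ q ∈ I, q ∈ 𝒜 a →
    ∃ x ∈ basisComponent b 1, x ∈ homogeneousPart 𝒜 b deg (a + D) ∧ lam x = q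

/-- `ρ` is a square-zero null-homotopy of the multiplication by `s` on a graded free resolution
of an ideal; it raises degrees by `E`. -/
structure IsSquareZeroHomotopy (𝒜 : A → σ) (b : Module.Basis (Σ i, Fin (m i)) S F)
    (deg : (Σ i, Fin (m i)) → A) (d : F →ₗ[S] F) (lam : F →ₗ[S] S) (s : S) (E : A)
    (ρ : F →ₗ[S] F) (u : F) : Prop where
  zero : ∀ x ∈ basisComponent b 0, ρ x = 0
  mem : ∀ i, ∀ x ∈ basisComponent b (i + 1), ρ x ∈ basisComponent b (i + 2)
  hom : ∀ a, ∀ x ∈ homogeneousPart 𝒜 b deg a, ρ x ∈ homogeneousPart 𝒜 b deg (a + E)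
  apply_apply : ∀ x, ρ (ρ x) = 0
  d_one : ∀ x ∈ basisComponent b 1, d (ρ x) = s • x - lam x • u
  d_add_two : ∀ i, ∀ x ∈ basisComponent b (i + 2), d (ρ x) + ρ (d x) = s • x

variable {𝒜 : A → σ} {b : Module.Basis (Σ i, Fin (m i)) S F}
  {deg : (Σ i, Fin (m i)) → A} {d : F →ₗ[S] F} {D : A} {I : Ideal S} {lam : F →ₗ[S] S}
  [DecidableEq A] [GradedRing 𝒜]

theorem homogeneousProj_mem_basisComponent {i : ℕ} {x : F} (hx : x ∈ basisComponent b i) (a : A) :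
    homogeneousProj 𝒜 b deg a x ∈ basisComponent b i := by
  intro k hk
  rw [repr_homogeneousProj, hx k hk]
  simp

theorem exists_homogeneous_preimage
    (hd : ∀ a, ∀ x ∈ homogeneousPart 𝒜 b deg a, d x ∈ homogeneousPart 𝒜 b deg a) {i : ℕ} {a : A}
    {x : F} (hx : x ∈ basisComponent b i) (hdx : d x ∈ homogeneousPart 𝒜 b deg a) :
    ∃ y ∈ basisComponent b i, y ∈ homogeneousPart 𝒜 b deg a ∧ d y = d x :=
  ⟨homogeneousProj 𝒜 b deg a x, homogeneousProj_mem_basisComponent hx a,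
    homogeneousProj_mem 𝒜 b deg a x, by
      rw [← homogeneousProj_map hd, homogeneousProj_of_mem hdx]⟩

/-- Lifting of a homogeneous map through the differential, one component at a time. -/
theorem exists_homogeneous_lift
    (hd : ∀ a, ∀ x ∈ homogeneousPart 𝒜 b deg a, d x ∈ homogeneousPart 𝒜 b deg a) {i l : ℕ} {e : A}
    {g : F →ₗ[S] F}
    (hg : ∀ a, ∀ x ∈ homogeneousPart 𝒜 b deg a, g x ∈ homogeneousPart 𝒜 b deg (a + e))
    (h : ∀ x ∈ basisComponent b i, ∃ y ∈ basisComponent b l, d y = g x) :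
    ∃ f : F →ₗ[S] F, (∀ x, f x ∈ basisComponent b l) ∧
      (∀ a, ∀ x ∈ homogeneousPart 𝒜 b deg a, f x ∈ homogeneousPart 𝒜 b deg (a + e)) ∧
      ∀ x ∈ basisComponent b i, d (f x) = g x := by
  have key : ∀ k : Σ i, Fin (m i), ∃ y ∈ basisComponent b l,
      y ∈ homogeneousPart 𝒜 b deg (deg k + e) ∧ (k.1 = i → d y = g (b k)) := by
    intro k
    by_cases hk : k.1 = i
    · obtain ⟨y, hy, hdy⟩ := h (b k) (hk ▸ basis_mem_basisComponent b k)
      obtain ⟨z, hz, hz', hdz⟩ := exists_homogeneous_preimage hd hy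
        (hdy ▸ hg _ _ (basis_mem_homogeneousPart 𝒜 b deg k))
      exact ⟨z, hz, hz', fun _ => hdz.trans hdy⟩
    · exact ⟨0, zero_mem _, zero_mem _, fun h => absurd h hk⟩
  choose y hy hy' hdy using key
  refine ⟨b.constr S y, fun x => ?_, fun a x hx => map_mem_homogeneousPart (fun k => ?_) hx,
    fun x hx => eqOn_basisComponent (f := d ∘ₗ b.constr S y) (g := g) (fun j => ?_) hx⟩
  · rw [b.constr_apply]
    exact sum_mem fun k _ => Submodule.smul_mem _ _ (hy k)
  · rw [b.constr_basis]; exact hy' k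
  · simpa using hdy ⟨i, j⟩ rfl

namespace IsIdealResolution

theorem exists_of_cycle {A : Type*} [AddCommGroup A] {𝒜 : A → σ} {deg : (Σ i, Fin (m i)) → A}
    {D : A} (h : IsIdealResolution 𝒜 b deg d D I lam) {i : ℕ} {x : F}
    (hx : x ∈ basisComponent b (i + 1)) (hdx : d x = 0) (hlx : lam x = 0) :
    ∃ y ∈ basisComponent b (i + 2), d y = x := by
  rcases i with _ | i
  · exact h.lam_exact x hx hlx
  · exact h.d_exact i x hx hdx

/-- Multiplication by an element of `I` is null-homotopic. -/
theorem exists_homotopy (h : IsIdealResolution 𝒜 b deg d D I lam) {s : S} {E : A} (hs : s ∈ I)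
    (hsE : s ∈ 𝒜 E) :
    ∃ (τ : F →ₗ[S] F) (u : F), (∀ x ∈ basisComponent b 0, τ x = 0) ∧
      (∀ i, ∀ x ∈ basisComponent b (i + 1), τ x ∈ basisComponent b (i + 2)) ∧
      (∀ a, ∀ x ∈ homogeneousPart 𝒜 b deg a, τ x ∈ homogeneousPart 𝒜 b deg (a + E)) ∧
      lam u = s ∧
      (∀ x ∈ basisComponent b 1, d (τ x) = s • x - lam x • u) ∧
      ∀ i, ∀ x ∈ basisComponent b (i + 2), d (τ x) + τ (d x) = s • x := by
  obtain ⟨u, hu, hu', hlu⟩ := h.exists_lam E s hs hsE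
  have hshom : ∀ a, ∀ x ∈ homogeneousPart 𝒜 b deg a, s • x ∈ homogeneousPart 𝒜 b deg (a + E) :=
    fun a x hx => add_comm E a ▸ smul_mem_homogeneousPart hsE hx
  -- `s x - lam(x) u` is killed by `lam` because `lam u = s`, so it is a boundary and can be lifted.
  obtain ⟨f₀, hf₀, hf₀', hf₀d⟩ := exists_homogeneous_lift (i := 1) (l := 2) (e := E) h.d_hom
    (g := s • LinearMap.id - lam.smulRight u) (fun a x hx => by
      refine sub_mem (hshom a x hx) ?_
      have := smul_mem_homogeneousPart (h.lam_hom a x hx) hu'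
      rwa [show a - D + (E + D) = a + E by abel] at this)
    (fun x hx => h.lam_exact _ (sub_mem (Submodule.smul_mem _ _ hx) (Submodule.smul_mem _ _ hu))
      (by simp [hlu, mul_comm]))
  simp only [LinearMap.sub_apply, LinearMap.smul_apply, LinearMap.id_apply,
    LinearMap.smulRight_apply] at hf₀d
  -- `f n` is the homotopy on `F_{n+1}`. The invariant that `d ∘ f n` is multiplication by `s` on
  -- cycles makes `s x - f n (d x)` a cycle, so that it can be lifted. Asking for both `d x = 0` and
  -- `lam x = 0` describes the cycles uniformly, degree one included.
  obtain ⟨f, hf0, hfQ, hfR⟩ := exists_seq_of_step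
    (fun n (f : F →ₗ[S] F) => (∀ x, f x ∈ basisComponent b (n + 2)) ∧
      (∀ a, ∀ x ∈ homogeneousPart 𝒜 b deg a, f x ∈ homogeneousPart 𝒜 b deg (a + E)) ∧
      ∀ x ∈ basisComponent b (n + 1), d x = 0 → lam x = 0 → d (f x) = s • x)
    (fun n f g => ∀ x ∈ basisComponent b (n + 2), d (g x) + f (d x) = s • x) (x₀ := f₀)
    ⟨hf₀, hf₀', fun x hx _ hlx => by rw [hf₀d x hx, hlx, zero_smul, sub_zero]⟩
    (by
      rintro n f ⟨hf, hf', hfd⟩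
      obtain ⟨g, hg, hg', hgd⟩ := exists_homogeneous_lift (i := n + 2) (l := n + 3) (e := E)
        h.d_hom (g := s • LinearMap.id - f ∘ₗ d)
        (fun a x hx => sub_mem (hshom a x hx) (hf' _ _ (h.d_hom _ _ hx)))
        (fun x hx => h.d_exact _ _ (sub_mem (Submodule.smul_mem _ _ hx) (hf _)) (by
          simp [hfd _ (h.d_mem _ _ hx) (h.d_d x) (h.lam_d x)]))
      simp only [LinearMap.sub_apply, LinearMap.smul_apply, LinearMap.id_apply,
        LinearMap.comp_apply] at hgd
      exact ⟨g, ⟨hg, hg', fun x hx hdx _ => by rw [hgd x hx, hdx, map_zero, sub_zero]⟩,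
        fun x hx => by rw [hgd x hx, sub_add_cancel]⟩)
  let τ : F →ₗ[S] F := b.constr S fun k => match k with
    | ⟨0, _⟩ => 0
    | ⟨n + 1, j⟩ => f n (b ⟨n + 1, j⟩)
  have hτ : ∀ n, ∀ x ∈ basisComponent b (n + 1), τ x = f n x := fun n x hx =>
    eqOn_basisComponent (fun j => by simp only [τ, b.constr_basis]) hx
  refine ⟨τ, u, fun x hx => ?_, fun i x hx => ?_, fun a x hx => ?_, hlu, fun x hx => ?_,
    fun i x hx => ?_⟩
  · exact eqOn_basisComponent (g := 0) (fun j => by simp [τ]) hx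
  · rw [hτ i x hx]; exact (hfQ i).1 x
  · refine map_mem_homogeneousPart (fun k => ?_) hx
    simp only [τ, b.constr_basis]
    rcases k with ⟨_ | n, j⟩
    · exact zero_mem _
    · exact (hfQ n).2.1 _ _ (basis_mem_homogeneousPart 𝒜 b deg _)
  · rw [hτ 0 x hx, hf0, hf₀d x hx]
  · rw [hτ (i + 1) x hx, hτ i _ (h.d_mem _ _ hx), hfR i x hx]

/-- Take `ρ = τdτ`. Since `dτ` is multiplication by `s` on cycles, `dτdτ = s dτ`, which gives a
homotopy for `s²`. Applying `dτ + τd = s` to `τdτ` then gives `dττdτ = sτdτ - τ(s dτ) = 0`, whence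
`ρ² = 0`. -/
theorem exists_squareZeroHomotopy (h : IsIdealResolution 𝒜 b deg d D I lam) {s : S} {E : A}
    (hs : s ∈ I) (hsE : s ∈ 𝒜 E) :
    ∃ (ρ : F →ₗ[S] F) (u : F), IsSquareZeroHomotopy 𝒜 b deg d lam (s * s) (E + E) ρ (s • u) := by
  obtain ⟨τ, u, hτ0, hτ, hτE, hu, hτ1, hτ2⟩ := h.exists_homotopy hs hsE
  have hcyc : ∀ i, ∀ x ∈ basisComponent b (i + 1), d x = 0 → lam x = 0 → d (τ x) = s • x := by
    rintro (_ | i) x hx hdx hlx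
    · rw [hτ1 x hx, hlx, zero_smul, sub_zero]
    · rw [← hτ2 i x hx, hdx, map_zero, add_zero]
  have hdτ : ∀ i, ∀ x ∈ basisComponent b (i + 1), d (τ (d (τ x))) = s • d (τ x) :=
    fun i x hx => hcyc i _ (h.d_mem _ _ (hτ i x hx)) (h.d_d _) (h.lam_d _)
  refine ⟨τ ∘ₗ d ∘ₗ τ, u, ⟨fun x hx => ?_, fun i x hx => ?_, fun a x hx => ?_, fun x => ?_,
    fun x hx => ?_, fun i x hx => ?_⟩⟩
  · simp [hτ0 x hx]
  · exact hτ i _ (h.d_mem _ _ (hτ i x hx))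
  · rw [← add_assoc]
    exact hτE _ _ (h.d_hom _ _ (hτE _ _ hx))
  · have : (τ ∘ₗ d ∘ₗ τ) ∘ₗ (τ ∘ₗ d ∘ₗ τ) = 0 := by
      refine linearMap_ext_basisComponent (b := b) fun i x hx => ?_
      rcases i with _ | i
      · simp [hτ0 x hx]
      · have h1 := hτ i x hx
        have h2 := h.d_mem _ _ h1
        have h3 := hτ i _ h2
        have e1 := hτ2 i _ h3
        rw [hdτ i x hx, map_smul] at e1
        have e2 : d (τ (τ (d (τ x)))) = s • τ (d (τ x)) - s • τ (d (τ x)) := eq_sub_of_add_eq e1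
        simp only [LinearMap.comp_apply, LinearMap.zero_apply]
        rw [e2, sub_self, map_zero]
    exact LinearMap.congr_fun this x
  · simp only [LinearMap.comp_apply]
    rw [hdτ 0 x hx, hτ1 x hx]
    module
  · simp only [LinearMap.comp_apply]
    rw [hdτ (i + 1) x hx, hcyc i _ (h.d_mem _ _ hx) (h.d_d x) (h.lam_d x), map_smul, ← smul_add,
      hτ2 i x hx, smul_smul]

end IsIdealResolution

end Contraction

/-! ### Elementary properties of minimal resolutions. -/

section MinimalFreeResolution

namespace IsMinimalFreeResolution

variable {S F : Type*} [CommRing S] [AddCommGroup F] [Module S F] {𝔪 J : Ideal S} {m : ℕ → ℕ}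
  {b : Module.Basis (Σ i, Fin (m i)) S F} {d : F →ₗ[S] F} {one : F}

theorem d_d (h : IsMinimalFreeResolution 𝔪 J (basisComponent b) d one) (x : F) :
    d (d x) = 0 := by
  have : d ∘ₗ d = 0 := by
    refine linearMap_ext_basisComponent (b := b) fun i x hx => ?_
    rcases i with _ | _ | i
    · simp [h.d_zero x hx]
    · exact h.d_zero _ (h.d_succ 0 x hx)
    · have : d x ∈ (basisComponent b (i + 2)).map d := Submodule.mem_map_of_mem hx
      rw [← h.exact] at this
      exact this.1
  exact LinearMap.congr_fun this x

theorem exists_of_d_eq_zero (h : IsMinimalFreeResolution 𝔪 J (basisComponent b) d one) {i : ℕ}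
    {x : F} (hx : x ∈ basisComponent b (i + 1)) (hdx : d x = 0) :
    ∃ y ∈ basisComponent b (i + 2), d y = x := by
  have : x ∈ LinearMap.ker d ⊓ basisComponent b (i + 1) := ⟨hdx, hx⟩
  rwa [h.exact] at this

theorem one_mem_basisComponent (h : IsMinimalFreeResolution 𝔪 J (basisComponent b) d one) :
    one ∈ basisComponent b 0 :=
  h.span_one ▸ Submodule.mem_span_singleton_self one

theorem exists_smul_one (h : IsMinimalFreeResolution 𝔪 J (basisComponent b) d one) {x : F}
    (hx : x ∈ basisComponent b 0) : ∃ r : S, r • one = x := by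
  rwa [h.span_one, Submodule.mem_span_singleton] at hx

theorem one_ne_zero (h : IsMinimalFreeResolution 𝔪 J (basisComponent b) d one) (hJ : J ≠ ⊤) :
    one ≠ 0 := by
  rintro rfl
  exact hJ ((Ideal.eq_top_iff_one _).2 ((h.smul_one_mem 1).1 (by simp)))

theorem smul_one_injective [IsDomain S]
    (h : IsMinimalFreeResolution 𝔪 J (basisComponent b) d one) (hJ : J ≠ ⊤) :
    Function.Injective (LinearMap.toSpanSingleton S F one) := by
  have := Module.Basis.isTorsionFree b
  rw [injective_iff_map_eq_zero]
  intro r hr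
  exact (smul_eq_zero.1 hr).resolve_right (h.one_ne_zero hJ)

/-- If `J = S` then `F₀` is contained in `d F₁`, hence in `𝔪 F`, which contains no basis element; so
`F₀ = 0`. Then all of `F₁` consists of cycles, hence of boundaries, and the argument repeats in each
degree. -/
theorem subsingleton_of_eq_top (h : IsMinimalFreeResolution 𝔪 J (basisComponent b) d one)
    (h𝔪 : 𝔪 ≠ ⊤) (hJ : J = ⊤) : Subsingleton F := by
  have hempty : ∀ i, (∀ x ∈ basisComponent b i, x ∈ 𝔪 • (⊤ : Submodule S F)) →
      ∀ x ∈ basisComponent b i, x = 0 := by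
    intro i hi x hx
    refine b.ext_elem fun k => ?_
    by_cases hk : k.1 = i
    · subst hk
      exact absurd (zero_mem _)
        (sub_self (b k) ▸ b.sub_notMem_smul_top h𝔪 k (hi _ (basis_mem_basisComponent b k)))
    · simpa using hx k hk
  have key : ∀ i, ∀ x ∈ basisComponent b i, x = 0 := by
    intro i
    induction i with
    | zero =>
      refine hempty 0 fun x hx => ?_
      obtain ⟨r, rfl⟩ := h.exists_smul_one hx
      obtain ⟨y, -, hy⟩ := (h.smul_one_mem r).2 (hJ ▸ trivial)
      exact hy ▸ h.minimal y
    | succ i ih =>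
      refine hempty (i + 1) fun x hx => ?_
      obtain ⟨y, -, hy⟩ := h.exists_of_d_eq_zero hx (ih _ (h.d_succ i x hx))
      exact hy ▸ h.minimal y
  have : (LinearMap.id : F →ₗ[S] F) = 0 := linearMap_ext_basisComponent (b := b) key
  exact ⟨fun x y => (LinearMap.congr_fun this x).trans (LinearMap.congr_fun this y).symm⟩

end IsMinimalFreeResolution

end MinimalFreeResolution

/-! ### From homotopies to DGA structures on graded resolutions. -/

section GradedResolution

open DirectSum

variable {S F A σ : Type*} [CommRing S] [AddCommGroup F] [Module S F] [AddCommGroup A]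
  [DecidableEq A] [SetLike σ S] [AddSubgroupClass σ S]

/-- The analogue of `IsInternallyGraded` over an arbitrary graded ring. -/
structure IsGradedComplex (𝒜 : A → σ) (𝓖 : A → AddSubgroup F) (𝓕 : ℕ → Submodule S F)
    (d : F →ₗ[S] F) (one : F) : Prop where
  isInternal : IsInternal 𝓖
  smul_mem : ∀ (a c : A) (r : S) (x : F), r ∈ 𝒜 a → x ∈ 𝓖 c → r • x ∈ 𝓖 (a + c)
  basis : ∀ i, ∃ (m : ℕ) (b : Module.Basis (Fin m) S (𝓕 i)) (deg : Fin m → A),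
    ∀ j, (b j : F) ∈ 𝓖 (deg j)
  d_mem : ∀ a, ∀ x ∈ 𝓖 a, d x ∈ 𝓖 a
  one_mem : one ∈ 𝓖 0

variable {𝒜 : A → σ} [GradedRing 𝒜]

theorem IsGradedComplex.exists_basis {𝓖 : A → AddSubgroup F} {𝓕 : ℕ → Submodule S F}
    {d : F →ₗ[S] F} {one : F} (h : IsGradedComplex 𝒜 𝓖 𝓕 d one) (h𝓕 : IsInternal 𝓕) :
    ∃ (m : ℕ → ℕ) (b : Module.Basis (Σ i, Fin (m i)) S F) (deg : (Σ i, Fin (m i)) → A),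
      𝓕 = basisComponent b ∧ 𝓖 = homogeneousPart 𝒜 b deg := by
  choose m v deg hdeg using h.basis
  refine ⟨m, h𝓕.collectedBasis v, fun k => deg k.1 k.2, exists_eq_basisComponent h𝓕 v,
    eq_homogeneousPart 𝒜 h.isInternal h.smul_mem _ _ fun k => ?_⟩
  rw [h𝓕.collectedBasis_coe]
  exact hdeg k.1 k.2

theorem isGradedComplex_homogeneousPart {m : ℕ → ℕ} {b : Module.Basis (Σ i, Fin (m i)) S F}
    {deg : (Σ i, Fin (m i)) → A} {d : F →ₗ[S] F} {one : F}
    (hd : ∀ a, ∀ x ∈ homogeneousPart 𝒜 b deg a, d x ∈ homogeneousPart 𝒜 b deg a)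
    (hone : one ∈ homogeneousPart 𝒜 b deg 0) :
    IsGradedComplex 𝒜 (homogeneousPart 𝒜 b deg) (basisComponent b) d one where
  isInternal := isInternal_homogeneousPart 𝒜 b deg
  smul_mem _ _ _ _ hr hx := smul_mem_homogeneousPart hr hx
  basis i := ⟨m i, basisComponentBasis b i, fun j => deg ⟨i, j⟩, fun j => by
    rw [coe_basisComponentBasis]; exact basis_mem_homogeneousPart 𝒜 b deg _⟩
  d_mem := hd
  one_mem := hone

namespace IsMinimalFreeResolution

variable {𝔪 J : Ideal S} {m : ℕ → ℕ} {b : Module.Basis (Σ i, Fin (m i)) S F}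
  {deg : (Σ i, Fin (m i)) → A} {d : F →ₗ[S] F} {one : F}

/-- Over a domain `F₀` is free on the nonzero element `one`; `π` is the coordinate of the
degree-zero component. -/
theorem exists_augmentation [IsDomain S]
    (h : IsMinimalFreeResolution 𝔪 J (basisComponent b) d one)
    (hone : one ∈ homogeneousPart 𝒜 b deg 0) (hJ : J ≠ ⊤) :
    ∃ π : F →ₗ[S] S, π one = 1 ∧ (∀ i, ∀ x ∈ basisComponent b (i + 1), π x = 0) ∧
      ∀ a, ∀ x ∈ homogeneousPart 𝒜 b deg a, π x ∈ 𝒜 a := by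
  have hinj := h.smul_one_injective hJ
  obtain ⟨π, hπ⟩ := LinearMap.exists_comp_eq_of_injective hinj
    (componentScale b (Pi.single 0 1))
    (fun x => h.exists_smul_one (componentScale_single_mem 0 x))
  simp only [LinearMap.toSpanSingleton_apply] at hπ
  refine ⟨π, hinj ?_, fun i x hx => hinj ?_, fun a x hx => ?_⟩
  · simp [hπ, componentScale_of_mem _ h.one_mem_basisComponent]
  · simp [hπ, componentScale_of_mem _ hx]
  · refine mem_of_smul_mem_homogeneousPart hone (h.one_ne_zero hJ) ?_
    rw [hπ, add_zero]
    intro k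
    rw [repr_componentScale]
    by_cases hk : k.1 = 0
    · simpa [hk] using hx k
    · simp [Pi.single_eq_of_ne hk]

/-- On `F₁` the differential takes values in `sI • one`. Both `s` and `one` can be cancelled, which
leaves `lam` with values in `I`, with the same kernel on `F₁` as `d`, and lowering degrees by that
of `s`. -/
theorem exists_isIdealResolution [IsDomain S] {s : S} {D : A} {I : Ideal S} (hs : s ≠ 0)
    (hsD : s ∈ 𝒜 D)
    (h : IsMinimalFreeResolution 𝔪 (Ideal.span {s} * I) (basisComponent b) d one)
    (hd : ∀ a, ∀ x ∈ homogeneousPart 𝒜 b deg a, d x ∈ homogeneousPart 𝒜 b deg a)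
    (hone : one ∈ homogeneousPart 𝒜 b deg 0) (hJ : Ideal.span {s} * I ≠ ⊤) :
    ∃ lam : F →ₗ[S] S, IsIdealResolution 𝒜 b deg d D I lam ∧
      ∀ x ∈ basisComponent b 1, d x = (s * lam x) • one := by
  have := Module.Basis.isTorsionFree b
  have hinj : Function.Injective (s • LinearMap.toSpanSingleton S F one) := fun x y hxy =>
    h.smul_one_injective hJ (smul_right_injective F hs hxy)
  have hproj : ∀ x, componentScale b (Pi.single 1 1) x ∈ basisComponent b 1 :=
    componentScale_single_mem 1
  have hI : ∀ x ∈ basisComponent b 1, ∃ q ∈ I, (s * q) • one = d x := by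
    intro x hx
    obtain ⟨r, hr⟩ := h.exists_smul_one (h.d_succ 0 x hx)
    have hrJ := (h.smul_one_mem r).1 ⟨x, hx, hr.symm⟩
    obtain ⟨q, hq, rfl⟩ := Ideal.mem_span_singleton_mul.1 hrJ
    exact ⟨q, hq, hr⟩
  obtain ⟨lam, hlam⟩ := LinearMap.exists_comp_eq_of_injective hinj
    (d ∘ₗ componentScale b (Pi.single 1 1)) (fun x => by
      obtain ⟨q, -, hq⟩ := hI _ (hproj x)
      exact ⟨q, by simpa [smul_smul] using hq⟩)
  simp only [LinearMap.comp_apply, LinearMap.smul_apply, LinearMap.toSpanSingleton_apply] at hlam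
  have hlam1 : ∀ x ∈ basisComponent b 1, s • lam x • one = d x := by
    intro x hx
    rw [hlam, componentScale_of_mem _ hx]; simp
  have hlam0 : ∀ i, i ≠ 1 → ∀ x ∈ basisComponent b i, lam x = 0 := by
    intro i hi x hx
    refine hinj ?_
    simp [hlam, componentScale_of_mem _ hx, Pi.single_eq_of_ne hi]
  have hzero : ∀ x ∈ basisComponent b 1, d x = 0 → lam x = 0 := by
    intro x hx hdx
    refine hinj ?_
    simp [hlam1 x hx, hdx]
  have hlam_hom : ∀ a, ∀ x ∈ homogeneousPart 𝒜 b deg a, lam x ∈ 𝒜 (a - D) := by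
    intro a x hx
    refine mem_of_mul_mem hsD hs (mem_of_smul_mem_homogeneousPart hone (h.one_ne_zero hJ) ?_)
    rw [sub_add_cancel, add_zero, mul_comm, ← smul_smul, hlam]
    refine hd _ _ fun k => ?_
    rw [repr_componentScale]
    by_cases hk : k.1 = 1
    · simpa [hk] using hx k
    · simp [Pi.single_eq_of_ne hk]
  refine ⟨lam, ⟨h.d_succ, hd, fun i x hx => h.exists_of_d_eq_zero hx, fun x hx hlx => ?_, h.d_d,
    fun x => ?_, hlam0 0 (by simp), fun i => hlam0 (i + 2) (by simp), hlam_hom, fun x => ?_,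
    fun a q hq hqa => ?_⟩, fun x hx => by rw [← hlam1 x hx, smul_smul]⟩
  · exact h.exists_of_d_eq_zero hx (by rw [← hlam1 x hx, hlx, zero_smul, smul_zero])
  · have : lam ∘ₗ d = 0 := by
      refine linearMap_ext_basisComponent (b := b) fun i x hx => ?_
      rcases i with _ | _ | i
      · simp [h.d_zero x hx]
      · exact hlam0 0 (by simp) _ (h.d_succ 0 x hx)
      · rcases eq_or_ne i 0 with rfl | hi
        · exact hzero _ (h.d_succ _ x hx) (h.d_d x)
        · exact hlam0 (i + 1) (by simpa using hi) _ (h.d_succ _ x hx)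
    exact LinearMap.congr_fun this x
  · obtain ⟨q, hq, hqx⟩ := hI _ (hproj x)
    have : lam x = q := hinj (by simpa [hlam, smul_smul] using hqx.symm)
    exact this ▸ hq
  · obtain ⟨x, hx, hdx⟩ := (h.smul_one_mem (s * q)).2 (Ideal.mem_span_singleton_mul.2 ⟨q, hq, rfl⟩)
    have hdx' : d x ∈ homogeneousPart 𝒜 b deg (a + D) := by
      rw [hdx, ← add_zero (a + D), add_comm a D]
      exact smul_mem_homogeneousPart (SetLike.GradedMul.mul_mem hsD hqa) hone
    obtain ⟨y, hy, hy', hdy⟩ := exists_homogeneous_preimage hd hx hdx'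
    refine ⟨y, hy, hy', hinj ?_⟩
    simp only [LinearMap.smul_apply, LinearMap.toSpanSingleton_apply]
    rw [hlam1 y hy, hdy, hdx, smul_smul]

/-- A square-zero homotopy for the multiplication by `s` on a resolution of `I` induces a DGA
structure on the resolution of `S ⧸ sI`. -/
theorem exists_isDGA_of_homotopy [IsDomain S] {s : S} {D : A} {lam : F →ₗ[S] S} {ρ : F →ₗ[S] F}
    {u : F} (h : IsMinimalFreeResolution 𝔪 J (basisComponent b) d one)
    (hone : one ∈ homogeneousPart 𝒜 b deg 0) (hJ : J ≠ ⊤)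
    (hd1 : ∀ x ∈ basisComponent b 1, d x = (s * lam x) • one)
    (hld : ∀ x, lam (d x) = 0) (hl0 : ∀ x ∈ basisComponent b 0, lam x = 0)
    (hl : ∀ i, ∀ x ∈ basisComponent b (i + 2), lam x = 0)
    (hlhom : ∀ a, ∀ x ∈ homogeneousPart 𝒜 b deg a, lam x ∈ 𝒜 (a - D))
    (hρ : IsSquareZeroHomotopy 𝒜 b deg d lam s D ρ u) :
    ∃ mul : F →ₗ[S] F →ₗ[S] F, IsDGA (basisComponent b) d one mul ∧
      ∀ a c, ∀ x ∈ homogeneousPart 𝒜 b deg a, ∀ y ∈ homogeneousPart 𝒜 b deg c,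
        mul x y ∈ homogeneousPart 𝒜 b deg (a + c) := by
  obtain ⟨π, hπ1, hπ, hπhom⟩ := h.exists_augmentation hone hJ
  refine ⟨trivialExtensionMul one π lam ρ (componentScale b fun i => (-1) ^ i),
    isDGA_trivialExtensionMul h.span_one h.d_zero h.d_succ hd1 hπ1 hπ
      (hl0 _ h.one_mem_basisComponent) hl hld (fun i x hx => componentScale_of_mem _ hx)
      (hρ.zero _ h.one_mem_basisComponent) hρ.mem hρ.apply_apply hρ.d_one hρ.d_add_two, ?_⟩
  intro a c x hx y hy
  have hlρ : ∀ {a c : A} {x y : F}, x ∈ homogeneousPart 𝒜 b deg a →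
      y ∈ homogeneousPart 𝒜 b deg c → lam x • ρ y ∈ homogeneousPart 𝒜 b deg (a + c) := by
    intro a c x y hx hy
    have := smul_mem_homogeneousPart (hlhom _ _ hx) (hρ.hom _ _ hy)
    -- The shifts of `lam` and `ρ` cancel, since both equal the degree of `s`.
    rwa [show a - D + (c + D) = a + c by abel] at this
  have hJx : componentScale b (fun i => (-1) ^ i) x ∈ homogeneousPart 𝒜 b deg a := by
    intro k
    rw [repr_componentScale]
    rcases neg_one_pow_eq_or S k.1 with hk | hk
    · simpa [hk] using hx k
    · simpa [hk] using hx k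
  rw [trivialExtensionMul_apply]
  refine add_mem (add_mem (sub_mem (add_mem ?_ ?_) ?_) (hlρ hx hy)) ?_
  · exact smul_mem_homogeneousPart (hπhom _ _ hx) hy
  · rw [add_comm]
    exact smul_mem_homogeneousPart (hπhom _ _ hy) hx
  · rw [← add_zero (a + c)]
    exact smul_mem_homogeneousPart (SetLike.GradedMul.mul_mem (hπhom _ _ hx) (hπhom _ _ hy)) hone
  · rw [add_comm]
    exact hlρ hy hJx

end IsMinimalFreeResolution

/-- The graded complex `(F, d)` carries a DGA structure which respects the grading. -/
def HasGradedDGA (𝓖 : A → AddSubgroup F) (𝓕 : ℕ → Submodule S F) (d : F →ₗ[S] F)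
    (one : F) : Prop :=
  ∃ mul : F →ₗ[S] F →ₗ[S] F, IsDGA 𝓕 d one mul ∧
    ∀ a c, ∀ x ∈ 𝓖 a, ∀ y ∈ 𝓖 c, mul x y ∈ 𝓖 (a + c)

variable {𝔪 J I : Ideal S} {𝓖 : A → AddSubgroup F} {𝓕 : ℕ → Submodule S F} {d : F →ₗ[S] F}
  {one : F}

theorem hasGradedDGA_of_subsingleton {A : Type*} [AddCommGroup A] {𝓖 : A → AddSubgroup F}
    [Subsingleton F] : HasGradedDGA 𝓖 𝓕 d one := by
  have hmem : ∀ (N : Submodule S F) (x : F), x ∈ N := fun N x =>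
    Subsingleton.elim (0 : F) x ▸ zero_mem N
  refine ⟨0, ⟨fun _ => Subsingleton.elim _ _, fun _ => Subsingleton.elim _ _,
    fun _ _ _ _ => Subsingleton.elim _ _, fun _ _ _ _ _ _ => hmem _ _,
    fun _ _ _ _ _ _ => Subsingleton.elim _ _, fun _ _ _ => Subsingleton.elim _ _⟩,
    fun a c x _ y _ => ?_⟩
  exact zero_mem (𝓖 (a + c))

theorem hasGradedDGA_of_eq_bot [IsDomain S]
    (h : IsMinimalFreeResolution 𝔪 J 𝓕 d one) (hG : IsGradedComplex 𝒜 𝓖 𝓕 d one)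
    (hJ : J = ⊥) : HasGradedDGA 𝓖 𝓕 d one := by
  obtain ⟨m, b, deg, rfl, rfl⟩ := hG.exists_basis h.isInternal
  have hJt : J ≠ ⊤ := hJ ▸ bot_ne_top
  -- Here `d` vanishes on `F₁`, so the construction applies with `s`, `lam` and `ρ` all zero.
  refine h.exists_isDGA_of_homotopy (s := 0) (D := 0) (lam := 0) (ρ := 0) (u := 0) hG.one_mem hJt
    (fun x hx => ?_) (by simp) (by simp) (by simp) (by simp) ⟨by simp, by simp, by simp, by simp,
      by simp, by simp⟩
  obtain ⟨r, hr⟩ := h.exists_smul_one (h.d_succ 0 x hx)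
  have := (h.smul_one_mem r).1 ⟨x, hx, hr.symm⟩
  rw [hJ, Ideal.mem_bot] at this
  rw [← hr, this]
  simp

theorem hasGradedDGA_of_mem [IsDomain S] (h𝔪 : 𝔪 ≠ ⊤) {s : S} {E : A} (hs : s ∈ I)
    (hs0 : s ≠ 0) (hsE : s ∈ 𝒜 E)
    (h : IsMinimalFreeResolution 𝔪 (Ideal.span {s * s} * I) 𝓕 d one)
    (hG : IsGradedComplex 𝒜 𝓖 𝓕 d one) : HasGradedDGA 𝓖 𝓕 d one := by
  obtain ⟨m, b, deg, rfl, rfl⟩ := hG.exists_basis h.isInternal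
  by_cases hJ : Ideal.span {s * s} * I = ⊤
  · have := h.subsingleton_of_eq_top h𝔪 hJ
    exact hasGradedDGA_of_subsingleton
  obtain ⟨lam, hlam, hd1⟩ := h.exists_isIdealResolution (mul_ne_zero hs0 hs0)
    (SetLike.GradedMul.mul_mem hsE hsE) hG.d_mem hG.one_mem hJ
  obtain ⟨ρ, u, hρ⟩ := hlam.exists_squareZeroHomotopy hs hsE
  exact h.exists_isDGA_of_homotopy hG.one_mem hJ hd1 hlam.lam_d hlam.lam_zero hlam.lam_add_two
    hlam.lam_hom hρ

end GradedResolution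

/-! ### Monomial ideals: degree bounds and division of the homotopy. -/

section Monomial

open MvPolynomial

theorem Module.Basis.exists_smul_eq_of_dvd {S F ι : Type*} [CommRing S] [AddCommGroup F]
    [Module S F] (b : Module.Basis ι S F) {c : S} {x : F} (h : ∀ i, c ∣ b.repr x i) :
    ∃ y, c • y = x := by
  change x ∈ LinearMap.range (LinearMap.lsmul S F c)
  rw [← b.linearCombination_repr x, Finsupp.linearCombination_apply]
  refine sum_mem fun i _ => ?_
  obtain ⟨q, hq⟩ := h i
  exact ⟨q • b i, by simp [hq, smul_smul, mul_comm]⟩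

theorem mem_basisComponent_of_smul_mem {S F : Type*} [CommRing S] [IsDomain S] [AddCommGroup F]
    [Module S F] {m : ℕ → ℕ} {b : Module.Basis (Σ i, Fin (m i)) S F} {c : S} (hc : c ≠ 0) {i : ℕ}
    {x : F} (h : c • x ∈ basisComponent b i) : x ∈ basisComponent b i := fun k hk => by
  simpa [hc] using h k hk

variable {k : Type*} [Field k] {n : ℕ}

theorem weight_fineWeight (e : Fin n →₀ ℕ) (i : Fin n) :
    Finsupp.weight (fineWeight n) e i = e i := by
  rw [Finsupp.weight_apply, Finsupp.sum_fintype _ _ (by simp)]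
  simp [fineWeight, Pi.single_apply]

theorem exists_eq_monomial_of_isWeightedHomogeneous {p : MvPolynomial (Fin n) k}
    {a : Fin n → ℤ} (hp : IsWeightedHomogeneous (fineWeight n) p a) (h0 : p ≠ 0) :
    ∃ e : Fin n →₀ ℕ, (∀ i, a i = e i) ∧ p = monomial e (coeff e p) := by
  obtain ⟨e, he⟩ := ne_zero_iff.1 h0
  have hw := hp he
  refine ⟨e, fun i => by rw [← hw, weight_fineWeight], ?_⟩
  ext e'
  rw [coeff_monomial]
  split_ifs with h
  · rw [h]
  · by_contra hne
    refine h (Finsupp.ext fun i => ?_)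
    have := congrFun (hw.trans (hp hne).symm) i
    rw [weight_fineWeight, weight_fineWeight] at this
    exact_mod_cast this

theorem monomial_one_mem (e : Fin n →₀ ℕ) :
    monomial e (1 : k) ∈ weightedHomogeneousSubmodule k (fineWeight n) (fun i => (e i : ℤ)) :=
  isWeightedHomogeneous_monomial _ _ _ (funext fun i => weight_fineWeight e i)

/-- A fine-homogeneous polynomial is a scalar times one monomial, so divisibility is an inequality
of degrees. It has to be checked only for nonnegative degrees, as otherwise the polynomial is zero.
-/
theorem monomial_dvd_of_isWeightedHomogeneous {p : MvPolynomial (Fin n) k}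
    {a : Fin n → ℤ} (hp : IsWeightedHomogeneous (fineWeight n) p a) {r : Fin n →₀ ℕ}
    (h : (∀ i, 0 ≤ a i) → ∀ i, (r i : ℤ) ≤ a i) : monomial r (1 : k) ∣ p := by
  by_cases h0 : p = 0
  · exact h0 ▸ dvd_zero _
  obtain ⟨e, he, hpe⟩ := exists_eq_monomial_of_isWeightedHomogeneous hp h0
  have hre : r ≤ e := fun i => by
    have := h (fun i => by simp [he]) i
    rw [he] at this
    exact_mod_cast this
  rw [hpe]
  exact ⟨monomial (e - r) (coeff e p), by rw [monomial_mul, one_mul, add_tsub_cancel_of_le hre]⟩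

theorem mem_monomialIdeal_iff {G : Finset (Fin n →₀ ℕ)} {p : MvPolynomial (Fin n) k} :
    p ∈ monomialIdeal k G ↔ ∀ e ∈ p.support, ∃ g ∈ G, g ≤ e :=
  mem_ideal_span_monomial_image

theorem monomial_mem_monomialIdeal_iff {G : Finset (Fin n →₀ ℕ)} {e : Fin n →₀ ℕ} :
    monomial e (1 : k) ∈ monomialIdeal k G ↔ ∃ g ∈ G, g ≤ e := by
  classical
  rw [mem_monomialIdeal_iff, support_monomial, if_neg one_ne_zero]
  simp

theorem monomial_mem_idealOfVars {r : Fin n →₀ ℕ} (hr : r ≠ 0) :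
    monomial r (1 : k) ∈ idealOfVars (Fin n) k := by
  obtain ⟨i, hi⟩ := DFunLike.ne_iff.1 hr
  have h1 : Finsupp.single i 1 ≤ r := by
    rw [Finsupp.single_le_iff]; exact Nat.one_le_iff_ne_zero.2 hi
  have : monomial r (1 : k) = monomial (r - Finsupp.single i 1) 1 * X i := by
    rw [X, monomial_mul, one_mul, tsub_add_cancel_of_le h1]
  rw [this]
  exact Ideal.mul_mem_left _ _ (Ideal.subset_span ⟨i, rfl⟩)

theorem idealOfVars_ne_top : idealOfVars (Fin n) k ≠ ⊤ := by
  intro h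
  have h1 : (1 : MvPolynomial (Fin n) k) ∈ idealOfVars (Fin n) k := h ▸ trivial
  have : idealOfVars (Fin n) k ≤ RingHom.ker (constantCoeff (R := k) (σ := Fin n)) := by
    rw [idealOfVars, Ideal.span_le]
    rintro _ ⟨i, rfl⟩
    simp
  simpa using this h1

attribute [local instance] weightedGradedAlgebra

variable {F : Type*} [AddCommGroup F] [Module (MvPolynomial (Fin n) k) F] {m : ℕ → ℕ}
  {b : Module.Basis (Σ i, Fin (m i)) (MvPolynomial (Fin n) k) F}
  {deg : (Σ i, Fin (m i)) → (Fin n → ℤ)} {d : F →ₗ[MvPolynomial (Fin n) k] F}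
  {lam : F →ₗ[MvPolynomial (Fin n) k] MvPolynomial (Fin n) k} {G : Finset (Fin n →₀ ℕ)}

/-- The degrees of the generators of a minimal free resolution of a monomial ideal are bounded
by the exponent of the least common multiple of the generators of the ideal. -/
theorem IsIdealResolution.deg_bounds
    (h : IsIdealResolution (weightedHomogeneousSubmodule k (fineWeight n)) b deg d
      (fun i => (lcmExponent G i : ℤ)) (monomialIdeal k G) lam)
    (hmin : ∀ x, d x ∈ idealOfVars (Fin n) k • (⊤ : Submodule (MvPolynomial (Fin n) k) F))
    (i : ℕ) : ∀ j : Fin (m (i + 1)), ∀ l : Fin n, (lcmExponent G l : ℤ) ≤ deg ⟨i + 1, j⟩ l ∧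
      deg ⟨i + 1, j⟩ l ≤ 2 * lcmExponent G l := by
  have hb0 : ∀ c, b c ∉ idealOfVars (Fin n) k •
      (⊤ : Submodule (MvPolynomial (Fin n) k) F) := fun c => by
    simpa using b.sub_notMem_smul_top idealOfVars_ne_top c (zero_mem _)
  -- By minimality a basis element is not congruent modulo `𝔪 F` to a multiple of a nontrivial
  -- monomial. Both upper bounds below come from this.
  have hmul : ∀ (c : Σ i, Fin (m i)) (r : Fin n →₀ ℕ) (x : F), b c - monomial r (1 : k) • x ∈
      idealOfVars (Fin n) k • (⊤ : Submodule (MvPolynomial (Fin n) k) F) → r = 0 := by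
    intro c r x hx
    by_contra hr
    exact b.sub_notMem_smul_top idealOfVars_ne_top c
      (Submodule.smul_mem_smul (monomial_mem_idealOfVars hr) trivial) hx
  induction i with
  | zero =>
    intro j
    set f := b ⟨0 + 1, j⟩ with hf
    have hf1 : f ∈ basisComponent b 1 := basis_mem_basisComponent b ⟨0 + 1, j⟩
    have hlf : lam f ≠ 0 := fun h0 => by
      obtain ⟨y, -, hy⟩ := h.lam_exact f hf1 h0
      exact hb0 ⟨0 + 1, j⟩ (hf ▸ hy ▸ hmin y)
    obtain ⟨e, he, hpe⟩ := exists_eq_monomial_of_isWeightedHomogeneous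
      (h.lam_hom _ _ (basis_mem_homogeneousPart _ b deg ⟨0 + 1, j⟩)) hlf
    have hesupp : e ∈ (lam f).support := by
      rw [mem_support_iff]
      intro h0
      rw [← hf] at hpe
      rw [h0, map_zero] at hpe
      exact hlf hpe
    obtain ⟨g, hg, hge⟩ := mem_monomialIdeal_iff.1 (h.lam_mem f) e hesupp
    have hgm : g ≤ lcmExponent G := Finset.le_sup (f := id) hg
    -- A generator dividing `x^e` divides the lcm too, so the truncated monomial stays in the ideal.
    -- If `x` is a preimage of it, then `f` and `x^(e-L) • x` have the same image, so their
    -- difference is a boundary and lies in `𝔪 F`. This forces `e ≤ L`.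
    have hmem : monomial (e ⊓ lcmExponent G) (coeff e (lam f)) ∈ monomialIdeal k G := by
      rw [mem_monomialIdeal_iff]
      intro e' he'
      rw [Finset.mem_singleton.1 (support_monomial_subset he')]
      exact ⟨g, hg, le_inf hge hgm⟩
    obtain ⟨x, hx, -, hlx⟩ := h.exists_lam (fun i => ((e ⊓ lcmExponent G) i : ℤ)) _ hmem
      (isWeightedHomogeneous_monomial _ _ _ (funext fun i => weight_fineWeight _ i))
    have hr : e - lcmExponent G = 0 := by
      refine hmul ⟨0 + 1, j⟩ _ x ?_
      obtain ⟨y, -, hy⟩ := h.lam_exact (f - monomial (e - lcmExponent G) (1 : k) • x)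
        (sub_mem hf1 (Submodule.smul_mem _ _ hx)) (by
          have he' : e - lcmExponent G + e ⊓ lcmExponent G = e := by
            ext l
            simp only [Finsupp.coe_add, Finsupp.coe_tsub, Finsupp.inf_apply, Pi.add_apply,
              Pi.sub_apply]
            omega
          rw [map_sub, map_smul, hlx, smul_eq_mul, monomial_mul, one_mul, he', sub_eq_zero]
          exact hpe)
      exact hy ▸ hmin y
    intro l
    have h1 := he l
    have h2 : e l ≤ lcmExponent G l := by
      have := DFunLike.congr_fun hr l
      simp only [Finsupp.coe_tsub, Pi.sub_apply, Finsupp.coe_zero, Pi.zero_apply] at this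
      omega
    simp only [Pi.sub_apply] at h1
    omega
  | succ i ih =>
    intro j
    set f := b ⟨i + 1 + 1, j⟩ with hf
    have hf1 : f ∈ basisComponent b (i + 2) := basis_mem_basisComponent b ⟨i + 1 + 1, j⟩
    have hdf := h.d_mem _ f hf1
    have hdf' := h.d_hom _ _ (basis_mem_homogeneousPart
      (weightedHomogeneousSubmodule k (fineWeight n)) b deg ⟨i + 1 + 1, j⟩)
    have hdf0 : d f ≠ 0 := fun h0 => by
      obtain ⟨y, -, hy⟩ := h.d_exact _ f hf1 h0
      exact hb0 ⟨i + 1 + 1, j⟩ (hf ▸ hy ▸ hmin y)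
    -- A nonzero entry of `d f` has nonnegative degree, so `deg f` dominates the degree of some
    -- generator one step below.
    have hge : ∀ l, (lcmExponent G l : ℤ) ≤ deg ⟨i + 1 + 1, j⟩ l := by
      obtain ⟨⟨i', j'⟩, hj'⟩ : ∃ c, b.repr (d f) c ≠ 0 := by
        by_contra! h0
        exact hdf0 (b.ext_elem fun c => by simp [h0 c])
      obtain rfl : i' = i + 1 := by
        by_contra hi
        exact hj' (hdf _ hi)
      obtain ⟨e, he, -⟩ := exists_eq_monomial_of_isWeightedHomogeneous (hdf' ⟨i + 1, j'⟩) hj'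
      intro l
      have h1 := he l
      have h2 := (ih j' l).1
      simp only [Pi.sub_apply] at h1
      omega
    -- The excess of `deg f` over `2L`. The generators one step below have degree at most `2L`, so
    -- `x^r` divides `d f`. The quotient is a cycle, hence some `d z`, and `f - x^r • z` is a
    -- boundary; minimality gives `r = 0`.
    let r : Fin n →₀ ℕ := Finsupp.equivFunOnFinite.symm fun l =>
      (deg ⟨i + 1 + 1, j⟩ l - 2 * lcmExponent G l).toNat
    have hrl : ∀ l, r l = (deg ⟨i + 1 + 1, j⟩ l - 2 * lcmExponent G l).toNat := fun l => rfl
    have hr0 : monomial r (1 : k) ≠ 0 := by simp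
    obtain ⟨y, hy⟩ := b.exists_smul_eq_of_dvd (c := monomial r (1 : k)) (x := d f) (by
      rintro ⟨i', j'⟩
      by_cases hi : i' = i + 1
      · subst hi
        refine monomial_dvd_of_isWeightedHomogeneous (hdf' ⟨i + 1, j'⟩) fun h0 l => ?_
        have h1 := h0 l
        have h2 := (ih j' l).2
        simp only [Pi.sub_apply] at h1 ⊢
        rw [hrl]
        omega
      · rw [hdf ⟨i', j'⟩ hi]; exact dvd_zero _)
    have hy1 : y ∈ basisComponent b (i + 1) := mem_basisComponent_of_smul_mem hr0 (hy ▸ hdf)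
    have := Module.Basis.isTorsionFree b
    have hdy : d y = 0 := smul_right_injective F hr0 (by
      simp only [← map_smul, hy, h.d_d, smul_zero])
    have hly : lam y = 0 := smul_right_injective _ hr0 (by
      simp only [← map_smul, hy, h.lam_d, smul_zero])
    obtain ⟨z, hz, hdz⟩ := h.exists_of_cycle hy1 hdy hly
    have hr : r = 0 := by
      refine hmul ⟨i + 1 + 1, j⟩ _ z ?_
      obtain ⟨y', -, hy'⟩ := h.d_exact i (f - monomial r (1 : k) • z)
        (sub_mem hf1 (Submodule.smul_mem _ _ hz)) (by
          rw [map_sub, map_smul, hdz, hy, sub_self])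
      exact hy' ▸ hmin y'
    intro l
    refine ⟨hge l, ?_⟩
    have h1 := hrl l
    rw [hr, Finsupp.coe_zero, Pi.zero_apply] at h1
    omega

/-- Over a monomial ideal, the square-zero homotopy for `s * s`, `s` the least common multiple of
the generators, can be divided by `s`. -/
theorem IsIdealResolution.exists_squareZeroHomotopy_lcm
    (h : IsIdealResolution (weightedHomogeneousSubmodule k (fineWeight n)) b deg d
      (fun i => (lcmExponent G i : ℤ)) (monomialIdeal k G) lam)
    (hmin : ∀ x, d x ∈ idealOfVars (Fin n) k • (⊤ : Submodule (MvPolynomial (Fin n) k) F))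
    (hG : G.Nonempty) :
    ∃ ρ u, IsSquareZeroHomotopy (weightedHomogeneousSubmodule k (fineWeight n)) b deg d lam
      (monomial (lcmExponent G) (1 : k)) (fun i => (lcmExponent G i : ℤ)) ρ u := by
  have hs0 : monomial (lcmExponent G) (1 : k) ≠ 0 := by simp
  have hsI : monomial (lcmExponent G) (1 : k) ∈ monomialIdeal k G := by
    obtain ⟨g, hg⟩ := hG
    exact monomial_mem_monomialIdeal_iff.2 ⟨g, hg, Finset.le_sup (f := id) hg⟩
  have hbd := h.deg_bounds hmin
  obtain ⟨ρ', u, hρ'⟩ := h.exists_squareZeroHomotopy hsI (monomial_one_mem _)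
  have := Module.Basis.isTorsionFree b
  have hinj := smul_right_injective F hs0
  have hdiv : ∀ x, ∃ y, monomial (lcmExponent G) (1 : k) • y = ρ' x := by
    intro x
    change ρ' x ∈ LinearMap.range (LinearMap.lsmul _ F (monomial (lcmExponent G) (1 : k)))
    rw [← b.linearCombination_repr x, Finsupp.linearCombination_apply, Finsupp.sum, map_sum]
    refine sum_mem fun c _ => ?_
    rw [map_smul]
    refine Submodule.smul_mem _ _ (b.exists_smul_eq_of_dvd fun c' => ?_)
    obtain ⟨_ | i, j⟩ := c
    · rw [hρ'.zero _ (basis_mem_basisComponent b ⟨0, j⟩)]; simp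
    have hmem := hρ'.mem i _ (basis_mem_basisComponent b ⟨i + 1, j⟩)
    have hhom := hρ'.hom _ _ (basis_mem_homogeneousPart _ b deg ⟨i + 1, j⟩)
    obtain ⟨i', j'⟩ := c'
    by_cases hi : i' = i + 2
    · subst hi
      -- The entry has degree `deg c + 2L - deg c'` with `deg c ≥ L` and `deg c' ≤ 2L`.
      refine monomial_dvd_of_isWeightedHomogeneous (hhom ⟨i + 2, j'⟩) fun _ l => ?_
      have h1 := (hbd i j l).1
      have h2 : deg ⟨i + 2, j'⟩ l ≤ _ := (hbd (i + 1) j' l).2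
      simp only [Pi.sub_apply, Pi.add_apply]
      omega
    · rw [hmem ⟨i', j'⟩ hi]; exact dvd_zero _
  obtain ⟨ρ, hρ⟩ := LinearMap.exists_comp_eq_of_injective
    (g := LinearMap.lsmul _ F (monomial (lcmExponent G) (1 : k))) hinj ρ' hdiv
  simp only [LinearMap.lsmul_apply] at hρ
  -- Every identity for `ρ` follows from that for `ρ'` by cancelling the lcm monomial; the square
  -- contains two factors of it.
  refine ⟨ρ, u, fun x hx => hinj ?_, fun i x hx => ?_, fun a x hx => ?_, fun x => hinj (hinj ?_),
    fun x hx => hinj ?_, fun i x hx => hinj ?_⟩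
  · simp [hρ, hρ'.zero x hx]
  · exact mem_basisComponent_of_smul_mem hs0 (hρ x ▸ hρ'.mem i x hx)
  · refine mem_homogeneousPart_of_smul_mem (monomial_one_mem _) hs0 ?_
    rw [hρ, add_assoc]
    exact hρ'.hom _ _ hx
  · simp only [← map_smul, hρ, hρ'.apply_apply, smul_zero]
  · simp only [← map_smul, hρ]
    rw [hρ'.d_one x hx, smul_sub, mul_smul, smul_comm (lam x)]
  · simp only [smul_add, ← map_smul d, hρ, smul_smul]
    exact hρ'.d_add_two i x hx

theorem hasGradedDGA_monomial {𝓖 : (Fin n → ℤ) → AddSubgroup F}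
    {𝓕 : ℕ → Submodule (MvPolynomial (Fin n) k) F} {one : F}
    (h : IsMinimalFreeResolution (idealOfVars (Fin n) k)
      (Ideal.span {monomial (lcmExponent G) (1 : k)} * monomialIdeal k G) 𝓕 d one)
    (hgr : IsGradedComplex (weightedHomogeneousSubmodule k (fineWeight n)) 𝓖 𝓕 d one) :
    HasGradedDGA 𝓖 𝓕 d one := by
  rcases G.eq_empty_or_nonempty with rfl | hG
  -- Without generators the lcm is `1`, which does not lie in the zero ideal.
  · exact hasGradedDGA_of_eq_bot h hgr (by simp [monomialIdeal])
  obtain ⟨m, b, deg, rfl, rfl⟩ := hgr.exists_basis h.isInternal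
  by_cases hJ : Ideal.span {monomial (lcmExponent G) (1 : k)} * monomialIdeal k G = ⊤
  · have := h.subsingleton_of_eq_top idealOfVars_ne_top hJ
    exact hasGradedDGA_of_subsingleton
  obtain ⟨lam, hlam, hd1⟩ := h.exists_isIdealResolution (by simp) (monomial_one_mem _) hgr.d_mem
    hgr.one_mem hJ
  obtain ⟨ρ, u, hρ⟩ := hlam.exists_squareZeroHomotopy_lcm h.minimal hG
  exact h.exists_isDGA_of_homotopy hgr.one_mem hJ hd1 hlam.lam_d hlam.lam_zero hlam.lam_add_two
    hlam.lam_hom hρ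

end Monomial

/-! ### Scaling the last map. -/

section LastMap

open DirectSum

variable {S F A σ : Type*} [CommRing S] [AddCommGroup F] [Module S F]

/-- Scaling by a nonzero `s` over a domain leaves the kernel on `F₁` unchanged and turns the image
`I` into `sI`. -/
theorem IsMinimalFreeResolution.exists_lastMapScaled [IsDomain S] {𝔪 I : Ideal S} {m : ℕ → ℕ}
    {b : Module.Basis (Σ i, Fin (m i)) S F} {d : F →ₗ[S] F} {one : F} {s : S} (hs : s ≠ 0)
    (h : IsMinimalFreeResolution 𝔪 I (basisComponent b) d one) (hI : I ≠ ⊤) :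
    ∃ d' : F →ₗ[S] F, IsLastMapScaled (basisComponent b) s d d' ∧
      IsMinimalFreeResolution 𝔪 (Ideal.span {s} * I) (basisComponent b) d' one := by
  -- Scaling before applying `d` keeps the image inside that of `d`, so minimality is inherited.
  let d' := d ∘ₗ componentScale b (Function.update 1 1 s)
  have h1 : ∀ x ∈ basisComponent b 1, d' x = s • d x := fun x hx => by
    simp [d', componentScale_of_mem _ hx]
  have hne : ∀ i, i ≠ 1 → ∀ x ∈ basisComponent b i, d' x = d x := fun i hi x hx => by
    simp [d', componentScale_of_mem _ hx, Function.update_of_ne hi]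
  have := Module.Basis.isTorsionFree b
  refine ⟨d', ⟨h1, hne⟩, h.isInternal, h.free, h.finite, fun x hx => ?_, fun i x hx => ?_,
    fun i => ?_, h.span_one, fun r => ?_, fun x => h.minimal _⟩
  · rw [hne 0 (by simp) x hx, h.d_zero x hx]
  · rcases eq_or_ne (i + 1) 1 with hi | hi
    · obtain rfl : i = 0 := by omega
      rw [h1 x hx]
      exact Submodule.smul_mem _ _ (h.d_succ 0 x hx)
    · rw [hne _ hi x hx]
      exact h.d_succ i x hx
  · have hmap : (basisComponent b (i + 2)).map d' = (basisComponent b (i + 2)).map d := by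
      ext y
      simp only [Submodule.mem_map]
      exact exists_congr fun x => and_congr_right fun hx => by rw [hne (i + 2) (by simp) x hx]
    rw [hmap, ← h.exact]
    ext x
    simp only [Submodule.mem_inf, LinearMap.mem_ker]
    refine and_congr_left fun hx => ?_
    rcases eq_or_ne (i + 1) 1 with hi | hi
    · obtain rfl : i = 0 := by omega
      rw [h1 x hx, smul_eq_zero, or_iff_right hs]
    · rw [hne _ hi x hx]
  · rw [Ideal.mem_span_singleton_mul]
    constructor
    · rintro ⟨x, hx, hdx⟩
      obtain ⟨q, hq⟩ := h.exists_smul_one (h.d_succ 0 x hx)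
      refine ⟨q, (h.smul_one_mem q).1 ⟨x, hx, hq.symm⟩, h.smul_one_injective hI ?_⟩
      rw [h1 x hx, ← hq, smul_smul] at hdx
      exact hdx
    · rintro ⟨q, hq, rfl⟩
      obtain ⟨x, hx, hdx⟩ := (h.smul_one_mem q).2 hq
      exact ⟨x, hx, by rw [h1 x hx, hdx, smul_smul]⟩

variable [AddCommGroup A] [DecidableEq A] [SetLike σ S] [AddSubgroupClass σ S] {𝒜 : A → σ}
  [GradedRing 𝒜]

theorem IsGradedComplex.exists_lastMapScaled [IsDomain S] {𝔪 I : Ideal S}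
    {𝓖 : A → AddSubgroup F} {𝓕 : ℕ → Submodule S F} {d : F →ₗ[S] F} {one : F} {s : S} {D : A}
    (hG : IsGradedComplex 𝒜 𝓖 𝓕 d one) (h : IsMinimalFreeResolution 𝔪 I 𝓕 d one) (hI : I ≠ ⊤)
    (hs : s ≠ 0) (hsD : s ∈ 𝒜 D) :
    ∃ (d' : F →ₗ[S] F) (𝓖' : A → AddSubgroup F), IsLastMapScaled 𝓕 s d d' ∧
      IsGradingShifted 𝓕 D 𝓖 𝓖' ∧ IsMinimalFreeResolution 𝔪 (Ideal.span {s} * I) 𝓕 d' one ∧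
      IsGradedComplex 𝒜 𝓖' 𝓕 d' one := by
  obtain ⟨m, b, deg, rfl, rfl⟩ := hG.exists_basis h.isInternal
  obtain ⟨d', hd', h'⟩ := h.exists_lastMapScaled hs hI
  let deg' : (Σ i, Fin (m i)) → A := fun k => if k.1 = 0 then deg k else deg k + D
  have hdeg0 : ∀ j, deg' ⟨0, j⟩ = deg ⟨0, j⟩ := fun j => by simp [deg']
  have hdeg : ∀ i j, deg' ⟨i + 1, j⟩ = deg ⟨i + 1, j⟩ + D := fun i j => by simp [deg']
  have key : ∀ i (a a' : A), (∀ j, a' - deg' ⟨i, j⟩ = a - deg ⟨i, j⟩) →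
      ∀ x ∈ basisComponent b i, x ∈ homogeneousPart 𝒜 b deg' a' ↔
        x ∈ homogeneousPart 𝒜 b deg a := by
    intro i a a' haa x hx
    rw [mem_homogeneousPart, mem_homogeneousPart]
    refine forall_congr' fun k => ?_
    by_cases hk : k.1 = i
    · subst hk; rw [haa]
    · rw [hx k hk]; simp
  have key0 : ∀ a, ∀ x ∈ basisComponent b 0, x ∈ homogeneousPart 𝒜 b deg' a ↔
        x ∈ homogeneousPart 𝒜 b deg a :=
    fun a => key 0 a a fun j => by rw [hdeg0]
  have key1 : ∀ i a, ∀ x ∈ basisComponent b (i + 1), x ∈ homogeneousPart 𝒜 b deg' (a + D) ↔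
        x ∈ homogeneousPart 𝒜 b deg a :=
    fun i a => key (i + 1) a (a + D) fun j => by rw [hdeg, add_sub_add_right_eq_sub]
  refine ⟨d', homogeneousPart 𝒜 b deg', hd', ⟨key0, key1⟩, h',
    isGradedComplex_homogeneousPart (fun a x hx => ?_)
      ((key0 0 one h.one_mem_basisComponent).2 hG.one_mem)⟩
  rw [← add_zero a]
  refine map_mem_homogeneousPart (fun c => ?_) hx
  rw [add_zero]
  have hbc := hG.d_mem _ _ (basis_mem_homogeneousPart 𝒜 b deg c)
  obtain ⟨_ | _ | i, j⟩ := c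
  · rw [h'.d_zero _ (basis_mem_basisComponent b ⟨0, j⟩)]
    exact zero_mem _
  · have hmem := basis_mem_basisComponent b ⟨0 + 1, j⟩
    rw [hd'.1 _ hmem, hdeg, add_comm]
    exact smul_mem_homogeneousPart hsD ((key0 _ _ (h.d_succ 0 _ hmem)).2 hbc)
  · have hmem := basis_mem_basisComponent b ⟨i + 1 + 1, j⟩
    rw [hd'.2 _ (by simp) _ hmem, hdeg]
    exact (key1 i _ _ (h.d_succ _ _ hmem)).2 hbc

end LastMap

/-! ### Minimal homogeneous covers. -/

section Existence

open DirectSum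

variable {S A σ : Type*} [CommRing S] [AddCommGroup A] [DecidableEq A] [SetLike σ S]
  [AddSubgroupClass σ S] (𝒜 : A → σ) [GradedRing 𝒜]

/-- Minimal homogeneous generators of a graded submodule of a free module, over a ring in which
an element outside `𝔪` has an invertible component of degree `0`. -/
theorem exists_minimal_generators [IsNoetherianRing S] {𝔪 : Ideal S}
    (h𝔪 : ∀ p : S, p ∉ 𝔪 → IsUnit (decompose 𝒜 p 0 : S)) {ι M : Type*} [Finite ι]
    [AddCommGroup M] [Module S M] (b : Module.Basis ι S M) (deg : ι → A) (N : Submodule S M)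
    (hN : ∀ x ∈ N, ∀ a, homogeneousProj 𝒜 b deg a x ∈ N) :
    ∃ (m : ℕ) (v : Fin m → M) (e : Fin m → A), (∀ j, v j ∈ homogeneousPart 𝒜 b deg (e j)) ∧
      Submodule.span S (Set.range v) = N ∧
      ∀ c : Fin m → S, ∑ j, c j • v j = 0 → ∀ j, c j ∈ 𝔪 := by
  classical
  have : Module.Finite S M := .of_basis b
  -- A homogeneous generating family of least cardinality is taken; its relations will have
  -- coefficients in `𝔪`.
  let P : ℕ → Prop := fun m => ∃ (v : Fin m → M) (e : Fin m → A),
    (∀ j, v j ∈ homogeneousPart 𝒜 b deg (e j)) ∧ Submodule.span S (Set.range v) = N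
  have hP : ∃ m, P m := by
    let T : Set M := {x | x ∈ N ∧ ∃ a, x ∈ homogeneousPart 𝒜 b deg a}
    have hT : Submodule.span S T = N := by
      refine le_antisymm (Submodule.span_le.2 fun x hx => hx.1) fun x hx => ?_
      obtain ⟨t, ht⟩ := exists_sum_homogeneousProj 𝒜 b deg x
      rw [← ht t le_rfl]
      exact sum_mem fun a _ => Submodule.subset_span
        ⟨hN x hx a, a, homogeneousProj_mem 𝒜 b deg a x⟩
    obtain ⟨t, ht, hspan⟩ := (Submodule.fg_span_iff_fg_span_finset_subset T).1
      (IsNoetherian.noetherian (Submodule.span S T))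
    choose e he using fun j : t => (ht j.2).2
    refine ⟨t.card, fun j => t.equivFin.symm j, fun j => e (t.equivFin.symm j),
      fun j => he _, ?_⟩
    rw [← hT, hspan]
    congr 1
    ext x
    constructor
    · rintro ⟨j, rfl⟩
      exact (t.equivFin.symm j).2
    · intro hx
      exact ⟨t.equivFin ⟨x, hx⟩, by simp⟩
  obtain ⟨v, e, hv, hspan⟩ := Nat.find_spec hP
  refine ⟨Nat.find hP, v, e, hv, hspan, ?_⟩
  intro c hc j₀
  by_contra hj₀
  -- In degree `e j₀` the coefficient of `v j₀` becomes the degree-zero part of `c j₀`, a unit if `c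
  -- j₀ ∉ 𝔪`. Then `v j₀` is redundant, contrary to the choice of the family.
  have hrel := congrArg (homogeneousProj 𝒜 b deg (e j₀)) hc
  simp only [map_sum, map_zero, homogeneousProj_smul (hv _)] at hrel
  obtain ⟨w, hw⟩ := h𝔪 _ hj₀
  have hmin := Nat.find_min hP (m := Nat.find hP - 1)
    (Nat.sub_lt (Nat.pos_of_ne_zero fun h0 => (h0 ▸ j₀).elim0) one_pos)
  refine hmin ?_
  obtain ⟨l, hl⟩ : ∃ l, Nat.find hP = l + 1 :=
    Nat.exists_eq_succ_of_ne_zero fun h0 => (h0 ▸ j₀).elim0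
  revert v e hv hspan c hc j₀ hj₀ hrel w hw hmin
  rw [hl]
  intro v e hv hspan c hc j₀ hj₀ hrel w hw hmin
  refine ⟨fun j => v (j₀.succAbove j), fun j => e (j₀.succAbove j), fun j => hv _, ?_⟩
  rw [← hspan]
  refine le_antisymm (Submodule.span_mono ?_) (Submodule.span_le.2 ?_)
  · rintro _ ⟨j, rfl⟩
    exact ⟨_, rfl⟩
  rintro _ ⟨j, rfl⟩
  rcases eq_or_ne j j₀ with rfl | hj
  · rw [Fin.sum_univ_succAbove _ j, sub_self, ← hw] at hrel
    have : v j = (↑w⁻¹ : S) • ((w : S) • v j) := by rw [smul_smul, Units.inv_mul, one_smul]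
    rw [this, eq_neg_of_add_eq_zero_left hrel]
    exact Submodule.smul_mem _ _ (neg_mem (sum_mem fun i _ => Submodule.smul_mem _ _
      (Submodule.subset_span ⟨i, rfl⟩)))
  · obtain ⟨i, rfl⟩ := Fin.exists_succAbove_eq hj
    exact Submodule.subset_span ⟨i, rfl⟩

/-- A graded submodule `N` of a free module over a graded ring. -/
structure GradedSubmoduleOfFree where
  rank : ℕ
  deg : Fin rank → A
  N : Submodule S (Fin rank → S)
  proj_mem : ∀ x ∈ N, ∀ a, homogeneousProj 𝒜 (Pi.basisFun S (Fin rank)) deg a x ∈ N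

variable {𝒜}

/-- One step of the resolution: the kernel of a minimal homogeneous cover is again a graded
submodule of a free module, so the step can be iterated. -/
theorem GradedSubmoduleOfFree.exists_cover [IsNoetherianRing S] {𝔪 : Ideal S}
    (h𝔪 : ∀ p : S, p ∉ 𝔪 → IsUnit (decompose 𝒜 p 0 : S)) (X : GradedSubmoduleOfFree 𝒜) :
    ∃ (Y : GradedSubmoduleOfFree 𝒜) (φ : (Fin Y.rank → S) →ₗ[S] (Fin X.rank → S)),
      LinearMap.range φ = X.N ∧ LinearMap.ker φ = Y.N ∧ (∀ y ∈ Y.N, ∀ j, y j ∈ 𝔪) ∧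
      ∀ j, φ (Pi.single j 1) ∈
        homogeneousPart 𝒜 (Pi.basisFun S (Fin X.rank)) X.deg (Y.deg j) := by
  obtain ⟨m, v, e, hv, hspan, hmin⟩ := exists_minimal_generators 𝒜 h𝔪
    (Pi.basisFun S (Fin X.rank)) X.deg X.N X.proj_mem
  let φ := Fintype.linearCombination S v
  have hφ : ∀ j, φ (Pi.single j 1) = v j := fun j => by
    simp [φ, Fintype.linearCombination_apply_single]
  have hφhom : ∀ a, ∀ x ∈ homogeneousPart 𝒜 (Pi.basisFun S (Fin m)) e a,
      φ x ∈ homogeneousPart 𝒜 (Pi.basisFun S (Fin X.rank)) X.deg a := fun a x hx => by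
    rw [← add_zero a]
    refine map_mem_homogeneousPart (fun j => ?_) hx
    rw [Pi.basisFun_apply, hφ, add_zero]
    exact hv j
  refine ⟨⟨m, e, LinearMap.ker φ, fun x hx a => ?_⟩, φ, ?_, rfl, fun y hy => ?_, fun j => ?_⟩
  · rw [LinearMap.mem_ker, ← homogeneousProj_map hφhom, LinearMap.mem_ker.1 hx, map_zero]
  · rw [← hspan, Fintype.range_linearCombination]
  · exact hmin y (by simpa [φ, Fintype.linearCombination_apply] using hy)
  · rw [hφ]; exact hv j

end Existence

/-! ### Assembling iterated covers into a resolution. -/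

section Assemble

variable {S : Type u} {F : Type*} {A σ : Type*} [CommRing S] [AddCommGroup F] [Module S F]
  {m : ℕ → ℕ}

/-- The inclusion of the `i`-th component of a free module with a basis divided into groups. -/
noncomputable def componentIncl (b : Module.Basis (Σ i, Fin (m i)) S F) (i : ℕ) :
    (Fin (m i) → S) →ₗ[S] F :=
  Fintype.linearCombination S fun j => b ⟨i, j⟩

theorem componentIncl_single (b : Module.Basis (Σ i, Fin (m i)) S F) (i : ℕ) (j : Fin (m i)) :
    componentIncl b i (Pi.single j 1) = b ⟨i, j⟩ := by
  simp [componentIncl, Fintype.linearCombination_apply_single]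

theorem range_componentIncl (b : Module.Basis (Σ i, Fin (m i)) S F) (i : ℕ) :
    LinearMap.range (componentIncl b i) = basisComponent b i := by
  rw [basisComponent_eq_span, componentIncl, Fintype.range_linearCombination]

theorem componentIncl_mem (b : Module.Basis (Σ i, Fin (m i)) S F) (i : ℕ) (x : Fin (m i) → S) :
    componentIncl b i x ∈ basisComponent b i :=
  range_componentIncl b i ▸ ⟨x, rfl⟩

theorem repr_componentIncl (b : Module.Basis (Σ i, Fin (m i)) S F) (i : ℕ) (x : Fin (m i) → S)
    (j : Fin (m i)) : b.repr (componentIncl b i x) ⟨i, j⟩ = x j := by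
  have : (Finsupp.lapply (⟨i, j⟩ : Σ i, Fin (m i)) ∘ₗ b.repr.toLinearMap) ∘ₗ componentIncl b i =
      LinearMap.proj j := by
    refine (Pi.basisFun S (Fin (m i))).ext fun l => ?_
    rw [Pi.basisFun_apply, LinearMap.comp_apply, componentIncl_single]
    by_cases h : l = j
    · subst h; simp
    · simp [Ne.symm h]
  exact LinearMap.congr_fun this x

theorem componentIncl_injective (b : Module.Basis (Σ i, Fin (m i)) S F) (i : ℕ) :
    Function.Injective (componentIncl b i) := fun x y h => by
  ext j
  rw [← repr_componentIncl b i x j, h, repr_componentIncl]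

theorem componentIncl_mem_smul_top (b : Module.Basis (Σ i, Fin (m i)) S F) (i : ℕ) {𝔪 : Ideal S}
    {x : Fin (m i) → S} (hx : ∀ j, x j ∈ 𝔪) :
    componentIncl b i x ∈ 𝔪 • (⊤ : Submodule S F) := by
  rw [componentIncl, Fintype.linearCombination_apply]
  exact sum_mem fun j _ => Submodule.smul_mem_smul (hx j) trivial

/-- Asking only that `o` span `S^{m 0}` covers both `m 0 = 1` and, for the zero module, `m 0 = 0`.
-/
theorem isMinimalFreeResolution_of_components {𝔪 J : Ideal S}
    (b : Module.Basis (Σ i, Fin (m i)) S F) {d : F →ₗ[S] F}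
    (φ : ∀ i, (Fin (m (i + 1)) → S) →ₗ[S] (Fin (m i) → S)) {o : Fin (m 0) → S}
    (hd0 : ∀ x, d (componentIncl b 0 x) = 0)
    (hd : ∀ i x, d (componentIncl b (i + 1) x) = componentIncl b i (φ i x))
    (hexact : ∀ i, LinearMap.range (φ (i + 1)) = LinearMap.ker (φ i))
    (hmin : ∀ i, ∀ x ∈ LinearMap.range (φ i), ∀ j, x j ∈ 𝔪)
    (ho : Submodule.span S {o} = ⊤) (hJ : ∀ r : S, r • o ∈ LinearMap.range (φ 0) ↔ r ∈ J) :
    IsMinimalFreeResolution 𝔪 J (basisComponent b) d (componentIncl b 0 o) where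
  isInternal := isInternal_basisComponent b
  free i := .of_basis (basisComponentBasis b i)
  finite i := .of_basis (basisComponentBasis b i)
  d_zero x hx := by
    rw [← range_componentIncl] at hx
    obtain ⟨x, rfl⟩ := hx
    exact hd0 x
  d_succ i x hx := by
    rw [← range_componentIncl] at hx
    obtain ⟨x, rfl⟩ := hx
    rw [hd]
    exact componentIncl_mem b i _
  exact i := by
    rw [← range_componentIncl, ← range_componentIncl]
    ext x
    constructor
    · rintro ⟨hx, x, rfl⟩
      rw [SetLike.mem_coe, LinearMap.mem_ker, hd] at hx
      have hx' : x ∈ LinearMap.ker (φ i) :=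
        componentIncl_injective b i (by rw [hx, map_zero])
      rw [← hexact] at hx'
      obtain ⟨y, rfl⟩ := hx'
      exact ⟨_, ⟨y, rfl⟩, hd _ _⟩
    · rintro ⟨_, ⟨y, rfl⟩, rfl⟩
      have hy : φ (i + 1) y ∈ LinearMap.ker (φ i) := hexact i ▸ ⟨y, rfl⟩
      rw [hd]
      exact ⟨by rw [SetLike.mem_coe, LinearMap.mem_ker, hd, LinearMap.mem_ker.1 hy, map_zero], _, rfl⟩
  span_one := by
    rw [← range_componentIncl, LinearMap.range_eq_map, ← ho, Submodule.map_span,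
      Set.image_singleton]
  smul_one_mem r := by
    rw [← hJ, ← range_componentIncl, ← map_smul]
    constructor
    · rintro ⟨_, ⟨x, rfl⟩, hx⟩
      rw [hd] at hx
      exact ⟨x, componentIncl_injective b 0 hx⟩
    · rintro ⟨x, hx⟩
      exact ⟨_, ⟨x, rfl⟩, by rw [hd, hx]⟩
  minimal x := by
    rw [← b.linearCombination_repr x, Finsupp.linearCombination_apply, Finsupp.sum, map_sum]
    refine sum_mem fun c _ => ?_
    rw [map_smul]
    refine Submodule.smul_mem _ _ ?_
    obtain ⟨_ | i, j⟩ := c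
    · rw [← componentIncl_single, hd0]; exact zero_mem _
    · rw [← componentIncl_single, hd]
      exact componentIncl_mem_smul_top b i (hmin i _ (LinearMap.mem_range_self _ _))

open DirectSum

variable [AddCommGroup A] [DecidableEq A] [SetLike σ S] [AddSubgroupClass σ S] {𝒜 : A → σ}
  [GradedRing 𝒜]

theorem componentIncl_mem_homogeneousPart (b : Module.Basis (Σ i, Fin (m i)) S F)
    (deg : (Σ i, Fin (m i)) → A) {i : ℕ} {a : A} {x : Fin (m i) → S}
    (hx : x ∈ homogeneousPart 𝒜 (Pi.basisFun S (Fin (m i))) (fun j => deg ⟨i, j⟩) a) :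
    componentIncl b i x ∈ homogeneousPart 𝒜 b deg a := by
  rw [← add_zero a]
  refine map_mem_homogeneousPart (fun j => ?_) hx
  rw [Pi.basisFun_apply, componentIncl_single, add_zero]
  exact basis_mem_homogeneousPart 𝒜 b deg ⟨i, j⟩

theorem GradedSubmoduleOfFree.exists_resolution [IsNoetherianRing S] {𝔪 J : Ideal S}
    (h𝔪 : ∀ p : S, p ∉ 𝔪 → IsUnit (decompose 𝒜 p 0 : S)) (X : GradedSubmoduleOfFree 𝒜)
    (hX : ∀ y ∈ X.N, ∀ j, y j ∈ 𝔪) {o : Fin X.rank → S} (ho : Submodule.span S {o} = ⊤)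
    (ho0 : o ∈ homogeneousPart 𝒜 (Pi.basisFun S (Fin X.rank)) X.deg 0)
    (hJ : ∀ r : S, r • o ∈ X.N ↔ r ∈ J) :
    ∃ (F : Type u) (_ : AddCommGroup F) (_ : Module S F) (𝓕 : ℕ → Submodule S F) (d : F →ₗ[S] F)
      (one : F) (𝓖 : A → AddSubgroup F),
      IsMinimalFreeResolution 𝔪 J 𝓕 d one ∧ IsGradedComplex 𝒜 𝓖 𝓕 d one := by
  choose Y φ hφr hφk hmin hφhom using GradedSubmoduleOfFree.exists_cover (𝒜 := 𝒜) h𝔪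
  -- The successive syzygy modules. The cover of the `i`-th has the next one as kernel, which is
  -- exactness.
  let Z : ℕ → GradedSubmoduleOfFree 𝒜 := fun i => Nat.rec X (fun _ => Y) i
  let b : Module.Basis (Σ i, Fin (Z i).rank) S ((Σ i, Fin (Z i).rank) →₀ S) :=
    Finsupp.basisSingleOne
  let deg : (Σ i, Fin (Z i).rank) → A := fun c => (Z c.1).deg c.2
  let ψ : ∀ i, (Fin (Z (i + 1)).rank → S) →ₗ[S] (Fin (Z i).rank → S) := fun i => φ (Z i)
  let d : ((Σ i, Fin (Z i).rank) →₀ S) →ₗ[S] ((Σ i, Fin (Z i).rank) →₀ S) :=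
    b.constr S fun c => match c with
      | ⟨0, _⟩ => 0
      | ⟨i + 1, j⟩ => componentIncl b i (ψ i (Pi.single j 1))
  have hd0 : ∀ x, d (componentIncl b 0 x) = 0 := by
    have : d ∘ₗ componentIncl b 0 = 0 := by
      refine (Pi.basisFun S _).ext fun j => ?_
      simp only [Pi.basisFun_apply, LinearMap.comp_apply, componentIncl_single, d,
        b.constr_basis, LinearMap.zero_apply]
    exact LinearMap.congr_fun this
  have hd : ∀ i x, d (componentIncl b (i + 1) x) = componentIncl b i (ψ i x) := by
    intro i
    have : d ∘ₗ componentIncl b (i + 1) = componentIncl b i ∘ₗ ψ i := by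
      refine (Pi.basisFun S _).ext fun j => ?_
      simp only [Pi.basisFun_apply, LinearMap.comp_apply, componentIncl_single, d,
        b.constr_basis]
    exact LinearMap.congr_fun this
  refine ⟨_, _, _, basisComponent b, d, componentIncl b 0 o, homogeneousPart 𝒜 b deg,
    isMinimalFreeResolution_of_components b ψ hd0 hd (fun i => ?_) (fun i => ?_) ho (fun r => ?_),
    isGradedComplex_homogeneousPart (fun a x hx => ?_)
      (componentIncl_mem_homogeneousPart b deg ho0)⟩
  · exact (hφr (Z (i + 1))).trans (hφk (Z i)).symm
  · rw [hφr (Z i)]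
    rcases i with _ | i
    · exact hX
    · exact hmin (Z i)
  · rw [hφr (Z 0)]
    exact hJ r
  · rw [← add_zero a]
    refine map_mem_homogeneousPart (fun c => ?_) hx
    obtain ⟨_ | i, j⟩ := c
    · rw [← componentIncl_single, hd0]; exact zero_mem _
    · rw [← componentIncl_single, hd, add_zero]
      exact componentIncl_mem_homogeneousPart b deg (hφhom (Z i) j)

/-- Existence of graded minimal free resolutions. -/
theorem exists_isMinimalFreeResolution [IsNoetherianRing S] {𝔪 J : Ideal S}
    (h𝔪 : ∀ p : S, p ∉ 𝔪 → IsUnit (decompose 𝒜 p 0 : S)) (hJ : J.IsHomogeneous 𝒜) :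
    ∃ (F : Type u) (_ : AddCommGroup F) (_ : Module S F) (𝓕 : ℕ → Submodule S F) (d : F →ₗ[S] F)
      (one : F) (𝓖 : A → AddSubgroup F),
      IsMinimalFreeResolution 𝔪 J 𝓕 d one ∧ IsGradedComplex 𝒜 𝓖 𝓕 d one := by
  by_cases hJt : J = ⊤
  -- The resolution of the zero module starts from rank `0`; otherwise `J ⊆ 𝔪`, and it starts from
  -- `J` inside the free module of rank one.
  · refine GradedSubmoduleOfFree.exists_resolution h𝔪
      ⟨0, Fin.elim0, ⊤, fun _ _ _ => trivial⟩ (fun _ _ j => j.elim0) (o := 0)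
      (Subsingleton.elim _ _) (zero_mem _) fun r => by simp [hJt]
  · have hle : ∀ p ∈ J, p ∈ 𝔪 := fun p hp => by
      by_contra hp'
      exact hJt (Ideal.eq_top_of_isUnit_mem _ (hJ 0 hp) (h𝔪 p hp'))
    refine GradedSubmoduleOfFree.exists_resolution h𝔪
      ⟨1, fun _ => 0, Submodule.comap (LinearMap.proj (R := S) (φ := fun _ : Fin 1 => S) 0) J,
        fun x hx a => ?_⟩ (fun y hy j => ?_) (o := fun _ => 1) ?_ ?_ fun r => ?_
    · have := repr_homogeneousProj 𝒜 (Pi.basisFun S (Fin 1)) (fun _ => 0) a x 0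
      rw [Pi.basisFun_repr, Pi.basisFun_repr] at this
      change homogeneousProj 𝒜 (Pi.basisFun S (Fin 1)) (fun _ => 0) a x 0 ∈ J
      rw [this]
      exact hJ _ hx
    · rw [Subsingleton.elim j 0]
      exact hle _ hy
    · rw [eq_top_iff]
      intro x _
      rw [Submodule.mem_span_singleton]
      exact ⟨x (0 : Fin 1), funext fun j => by
        simpa using congrArg x (Subsingleton.elim (0 : Fin 1) j)⟩
    · intro j
      simpa using SetLike.GradedOne.one_mem (A := 𝒜)
    · simp

end Assemble

/-! ### Local rings, with the trivial grading. -/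

section Local

open DirectSum IsLocalRing

/-- The grading of a ring which is concentrated in the only degree of the trivial group. -/
def trivialGrading (S : Type*) [CommRing S] : Unit → AddSubgroup S := fun _ => ⊤

theorem isInternal_top {M : Type*} [AddCommGroup M] :
    IsInternal (fun _ : Unit => (⊤ : AddSubgroup M)) :=
  isInternal_of_proj _ (fun _ => AddMonoidHom.id M) (fun _ _ _ => rfl)
    (fun _ _ h => absurd rfl h)
    (fun _ => AddSubgroup.subset_closure (Set.mem_iUnion.2 ⟨(), trivial⟩))

/-- The trivial grading makes a ring a graded ring. -/
@[reducible]
noncomputable def trivialGradedRing (S : Type*) [CommRing S] : GradedRing (trivialGrading S) where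
  one_mem := trivial
  mul_mem _ _ _ _ _ _ := trivial
  toDecomposition := IsInternal.chooseDecomposition _ isInternal_top

attribute [local instance] trivialGradedRing

variable {S : Type u} [CommRing S]

theorem decompose_trivialGrading (p : S) (a : Unit) :
    (decompose (trivialGrading S) p a : S) = p :=
  decompose_of_mem_same _ trivial

theorem IsMinimalFreeResolution.isGradedComplex_top [Nontrivial S] {F : Type*} [AddCommGroup F]
    [Module S F] {𝔪 J : Ideal S} {𝓕 : ℕ → Submodule S F} {d : F →ₗ[S] F} {one : F}
    (h : IsMinimalFreeResolution 𝔪 J 𝓕 d one) :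
    IsGradedComplex (trivialGrading S) (fun _ => ⊤) 𝓕 d one where
  isInternal := isInternal_top
  smul_mem _ _ _ _ _ _ := trivial
  basis i := by
    have := h.free i
    have := h.finite i
    exact ⟨_, Module.finBasis S (𝓕 i), fun _ => (), fun _ => trivial⟩
  d_mem _ _ _ := trivial
  one_mem := trivial

theorem exists_localMinimalResolutionAdmitsDGA [IsLocalRing S] [IsNoetherianRing S] [IsDomain S]
    (I : Ideal S) : ∃ s : S, s ≠ 0 ∧ LocalMinimalResolutionAdmitsDGA (Ideal.span {s} * I) ∧
      (I ≠ ⊤ → LocalResolutionsDifferInLastMap I s) := by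
  have h𝔪 : ∀ p : S, p ∉ maximalIdeal S → IsUnit (decompose (trivialGrading S) p 0 : S) := by
    intro p hp
    rw [decompose_trivialGrading]
    simpa using hp
  have hex : ∀ J : Ideal S, ∃ (F : Type u) (_ : AddCommGroup F) (_ : Module S F)
      (𝓕 : ℕ → Submodule S F) (d : F →ₗ[S] F) (one : F),
      IsMinimalFreeResolution (maximalIdeal S) J 𝓕 d one := by
    intro J
    obtain ⟨F, i₁, i₂, 𝓕, d, one, -, h, -⟩ := exists_isMinimalFreeResolution h𝔪 (J := J)
      fun a p hp => by rwa [decompose_trivialGrading]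
    exact ⟨F, i₁, i₂, 𝓕, d, one, h⟩
  have hlast : ∀ s : S, s ≠ 0 → I ≠ ⊤ → LocalResolutionsDifferInLastMap I s := by
    intro s hs hI F _ _ 𝓕 d one h
    obtain ⟨d', -, hd', -, h', -⟩ :=
      h.isGradedComplex_top.exists_lastMapScaled (D := ()) h hI hs trivial
    exact ⟨d', hd', h'⟩
  have hne : maximalIdeal S ≠ ⊤ := (maximalIdeal.isMaximal S).ne_top
  by_cases hI : I = ⊥
  · refine ⟨1, one_ne_zero, ⟨hex _, fun F _ _ 𝓕 d one h => ?_⟩, hlast 1 one_ne_zero⟩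
    obtain ⟨mul, hmul, -⟩ := hasGradedDGA_of_eq_bot h h.isGradedComplex_top (by simp [hI])
    exact ⟨mul, hmul⟩
  · obtain ⟨s, hsI, hs⟩ := Submodule.exists_mem_ne_zero_of_ne_bot hI
    -- Any nonzero element of `I` may be squared to give the multiplier.
    refine ⟨s * s, mul_ne_zero hs hs, ⟨hex _, fun F _ _ 𝓕 d one h => ?_⟩,
      hlast _ (mul_ne_zero hs hs)⟩
    obtain ⟨mul, hmul, -⟩ := hasGradedDGA_of_mem (𝒜 := trivialGrading S) (E := ()) hne hsI hs trivial h
      h.isGradedComplex_top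
    exact ⟨mul, hmul⟩

end Local

/-! ### Polynomial rings with the standard and the fine grading. -/

section Polynomial

open MvPolynomial DirectSum

attribute [local instance] weightedGradedAlgebra

variable {k : Type u} [Field k] {n : ℕ} {A : Type} [AddCommGroup A] [DecidableEq A]
  {w : Fin n → A}

theorem isInternallyGraded_iff {F : Type*} [AddCommGroup F] [Module (MvPolynomial (Fin n) k) F]
    {𝓖 : A → AddSubgroup F} {𝓕 : ℕ → Submodule (MvPolynomial (Fin n) k) F}
    {d : F →ₗ[MvPolynomial (Fin n) k] F} {one : F} :
    IsInternallyGraded w 𝓖 𝓕 d one ↔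
      IsGradedComplex (weightedHomogeneousSubmodule k w) 𝓖 𝓕 d one :=
  ⟨fun h => ⟨h.isInternal, h.smul_mem, h.basis, h.d_mem, h.one_mem⟩,
    fun h => ⟨h.isInternal, h.smul_mem, h.basis, h.d_mem, h.one_mem⟩⟩

/-- As only the exponent `0` has weight `0`, the degree-zero part is the constant term, which is
nonzero outside the irrelevant ideal. -/
theorem isUnit_decompose_zero (hw : ∀ e : Fin n →₀ ℕ, Finsupp.weight w e = 0 → e = 0)
    (p : MvPolynomial (Fin n) k) (hp : p ∉ idealOfVars (Fin n) k) :
    IsUnit (decompose (weightedHomogeneousSubmodule k w) p 0 : MvPolynomial (Fin n) k) := by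
  have hcoeff : coeff 0 p ≠ 0 := by
    intro h0
    rw [← pow_one (idealOfVars (Fin n) k), mem_pow_idealOfVars_iff] at hp
    refine hp fun e he => Nat.one_le_iff_ne_zero.2 fun hdeg => ?_
    rw [Finsupp.degree_eq_zero_iff] at hdeg
    exact mem_support_iff.1 he (hdeg ▸ h0)
  have : (decompose (weightedHomogeneousSubmodule k w) p 0 : MvPolynomial (Fin n) k) =
      C (coeff 0 p) := by
    change ((weightedDecomposition k w).decompose' p 0 : MvPolynomial (Fin n) k) = _
    rw [weightedDecomposition.decompose'_apply]
    ext e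
    rw [coeff_weightedHomogeneousComponent, coeff_C]
    by_cases he : e = 0
    · subst he; simp
    · rw [if_neg fun h => he (hw e h), if_neg (Ne.symm he)]
  rw [this]
  exact (isUnit_iff_ne_zero.2 hcoeff).map C

theorem gradedMinimalResolutionAdmitsDGA {J : Ideal (MvPolynomial (Fin n) k)}
    (hw : ∀ e : Fin n →₀ ℕ, Finsupp.weight w e = 0 → e = 0)
    (hJ : J.IsHomogeneous (weightedHomogeneousSubmodule k w))
    (h : ∀ (F : Type u) [AddCommGroup F] [Module (MvPolynomial (Fin n) k) F]
      (𝓕 : ℕ → Submodule (MvPolynomial (Fin n) k) F) (d : F →ₗ[MvPolynomial (Fin n) k] F)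
      (one : F) (𝓖 : A → AddSubgroup F),
      IsMinimalFreeResolution (idealOfVars (Fin n) k) J 𝓕 d one →
        IsGradedComplex (weightedHomogeneousSubmodule k w) 𝓖 𝓕 d one →
          HasGradedDGA 𝓖 𝓕 d one) :
    GradedMinimalResolutionAdmitsDGA w J := by
  refine ⟨?_, fun F _ _ 𝓕 d one 𝓖 hF hG => h F 𝓕 d one 𝓖 hF (isInternallyGraded_iff.1 hG)⟩
  obtain ⟨F, i₁, i₂, 𝓕, d, one, 𝓖, hF, hG⟩ :=
    exists_isMinimalFreeResolution (isUnit_decompose_zero hw) hJ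
  exact ⟨F, i₁, i₂, 𝓕, d, one, 𝓖, hF, isInternallyGraded_iff.2 hG⟩

theorem gradedResolutionsDifferInLastMap {I : Ideal (MvPolynomial (Fin n) k)}
    {s : MvPolynomial (Fin n) k} {D : A} (hs : s ≠ 0)
    (hsD : s ∈ weightedHomogeneousSubmodule k w D) (hI : I ≠ ⊤) :
    GradedResolutionsDifferInLastMap w I s D := by
  intro F _ _ 𝓕 d one 𝓖 h hG
  obtain ⟨d', 𝓖', h1, h2, h3, h4⟩ :=
    (isInternallyGraded_iff.1 hG).exists_lastMapScaled h hI hs hsD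
  exact ⟨d', 𝓖', h1, h2, h3, isInternallyGraded_iff.2 h4⟩

theorem isHomogeneous_span_singleton_mul {I : Ideal (MvPolynomial (Fin n) k)}
    {s : MvPolynomial (Fin n) k} {D : A} (hsD : s ∈ weightedHomogeneousSubmodule k w D)
    (hI : I.IsHomogeneous (weightedHomogeneousSubmodule k w)) :
    (Ideal.span {s} * I).IsHomogeneous (weightedHomogeneousSubmodule k w) :=
  (Ideal.homogeneous_span _ _ (by rintro _ rfl; exact ⟨D, hsD⟩)).mul hI

theorem weight_standardWeight (e : Fin n →₀ ℕ) :
    Finsupp.weight (standardWeight n) e = (e.degree : ℤ) := by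
  rw [Finsupp.weight_apply, Finsupp.degree_eq_sum, Finsupp.sum_fintype _ _ (by simp)]
  simp [standardWeight]

theorem MvPolynomial.IsHomogeneous.mem_standardWeight {p : MvPolynomial (Fin n) k} {D : ℕ}
    (hp : p.IsHomogeneous D) : p ∈ weightedHomogeneousSubmodule k (standardWeight n) (D : ℤ) := by
  intro e he
  rw [weight_standardWeight, ← hp he, Finsupp.degree_eq_weight_one]
  rfl

theorem isHomogeneous_standardWeight {I : Ideal (MvPolynomial (Fin n) k)}
    (hI : ∀ p ∈ I, ∀ i : ℕ, homogeneousComponent i p ∈ I) :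
    I.IsHomogeneous (weightedHomogeneousSubmodule k (standardWeight n)) := by
  have hspan : I = Ideal.span {p | p ∈ I ∧ ∃ D, p.IsHomogeneous D} := by
    refine le_antisymm (fun p hp => ?_) (Ideal.span_le.2 fun p hp => hp.1)
    rw [← sum_homogeneousComponent p]
    exact sum_mem fun i _ => Ideal.subset_span
      ⟨hI p hp i, i, homogeneousComponent_isHomogeneous i p⟩
  rw [hspan]
  exact Ideal.homogeneous_span _ _ fun p hp => hp.2.elim fun D hD => ⟨D, hD.mem_standardWeight⟩

theorem exists_gradedMinimalResolutionAdmitsDGA (I : Ideal (MvPolynomial (Fin n) k))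
    (hI : ∀ p ∈ I, ∀ i : ℕ, homogeneousComponent i p ∈ I) :
    ∃ (s : MvPolynomial (Fin n) k) (D : ℕ), s ≠ 0 ∧ s.IsHomogeneous D ∧
      GradedMinimalResolutionAdmitsDGA (standardWeight n) (Ideal.span {s} * I) ∧
      (I ≠ ⊤ → GradedResolutionsDifferInLastMap (standardWeight n) I s (D : ℤ)) := by
  have hw : ∀ e : Fin n →₀ ℕ, Finsupp.weight (standardWeight n) e = 0 → e = 0 := by
    intro e he
    rw [weight_standardWeight] at he
    rw [← Finsupp.degree_eq_zero_iff]
    exact_mod_cast he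
  have hI' := isHomogeneous_standardWeight hI
  by_cases hbot : I = ⊥
  · have h1 : (1 : MvPolynomial (Fin n) k).IsHomogeneous 0 := isHomogeneous_one _ _
    refine ⟨1, 0, one_ne_zero, h1, gradedMinimalResolutionAdmitsDGA hw
      (isHomogeneous_span_singleton_mul h1.mem_standardWeight hI')
      fun F _ _ 𝓕 d one 𝓖 h hG => hasGradedDGA_of_eq_bot h hG (by simp [hbot]),
      gradedResolutionsDifferInLastMap one_ne_zero h1.mem_standardWeight⟩
  · obtain ⟨p, hpI, hp⟩ := Submodule.exists_mem_ne_zero_of_ne_bot hbot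
    -- The multiplier must be homogeneous, so a nonzero homogeneous component of `p` is squared.
    obtain ⟨i, hi⟩ : ∃ i, homogeneousComponent i p ≠ 0 := by
      by_contra! h0
      exact hp (by rw [← sum_homogeneousComponent p]; simp [h0])
    have hs := homogeneousComponent_isHomogeneous i p
    refine ⟨_, _, mul_ne_zero hi hi, hs.mul hs, gradedMinimalResolutionAdmitsDGA hw
      (isHomogeneous_span_singleton_mul (hs.mul hs).mem_standardWeight hI')
      fun F _ _ 𝓕 d one 𝓖 h hG => hasGradedDGA_of_mem idealOfVars_ne_top (hI p hpI i) hi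
        hs.mem_standardWeight h hG,
      gradedResolutionsDifferInLastMap (mul_ne_zero hi hi) (hs.mul hs).mem_standardWeight⟩

theorem gradedMinimalResolutionAdmitsDGA_monomialIdeal (G : Finset (Fin n →₀ ℕ)) :
    GradedMinimalResolutionAdmitsDGA (fineWeight n)
      (Ideal.span {monomial (lcmExponent G) (1 : k)} * monomialIdeal k G) := by
  refine gradedMinimalResolutionAdmitsDGA (fun e he => ?_)
    (isHomogeneous_span_singleton_mul (monomial_one_mem _) ?_)
    fun F _ _ 𝓕 d one 𝓖 h hG => hasGradedDGA_monomial h hG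
  · ext i
    have := congrFun he i
    rw [weight_fineWeight, Pi.zero_apply] at this
    exact_mod_cast this
  · refine Ideal.homogeneous_span _ _ ?_
    rintro _ ⟨g, -, rfl⟩
    exact ⟨_, monomial_one_mem g⟩

end Polynomial

theorem theorem2p1 :
    -- regular local rings
    (∀ (S : Type u) [CommRing S] [IsRegularLocalRing S] (I : Ideal S),
      ∃ s : S, s ≠ 0 ∧
        LocalMinimalResolutionAdmitsDGA (Ideal.span {s} * I) ∧
        (I ≠ ⊤ → LocalResolutionsDifferInLastMap I s)) ∧
    -- homogeneous ideals in polynomial rings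
    (∀ (k : Type u) [Field k] (n : ℕ) (I : Ideal (MvPolynomial (Fin n) k)),
      (∀ p ∈ I, ∀ i : ℕ, MvPolynomial.homogeneousComponent i p ∈ I) →
      ∃ (s : MvPolynomial (Fin n) k) (D : ℕ), s ≠ 0 ∧ s.IsHomogeneous D ∧
        GradedMinimalResolutionAdmitsDGA (standardWeight n) (Ideal.span {s} * I) ∧
        (I ≠ ⊤ → GradedResolutionsDifferInLastMap (standardWeight n) I s (D : ℤ))) ∧
    -- monomial ideals in polynomial rings
    (∀ (k : Type u) [Field k] (n : ℕ) (G : Finset (Fin n →₀ ℕ)),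
      GradedMinimalResolutionAdmitsDGA (fineWeight n)
        (Ideal.span {MvPolynomial.monomial (lcmExponent G) (1 : k)} * monomialIdeal k G) ∧
      (monomialIdeal k G ≠ ⊤ →
        GradedResolutionsDifferInLastMap (fineWeight n) (monomialIdeal k G)
          (MvPolynomial.monomial (lcmExponent G) (1 : k)) (fun i => (lcmExponent G i : ℤ)))) := by
  refine ⟨fun S _ _ I => ?_, fun k _ n I hI => exists_gradedMinimalResolutionAdmitsDGA I hI,
    fun k _ n G => ⟨gradedMinimalResolutionAdmitsDGA_monomialIdeal G,
      gradedResolutionsDifferInLastMap (by simp) (monomial_one_mem _)⟩⟩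
  have := IsRegularLocalRing.isDomain S
  exact exists_localMinimalResolutionAdmitsDGA I
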